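/- \textbf{Setting.} Let $m,n\in\mathbb N$, $T>0$, $p\in[1,+\infty)$ and $\beta_1,\beta_2,\beta_3\ge 0$. Let $\mathbb R^n,\mathbb R^m$ carry the Euclidean norm, $\mathbb R^{m\times n}$ the spectral norm $\|\cdot\|_2$, and $\mathbb R^{m\times n}\times\mathbb R\times\mathbb R$ the norm $\|(U,\eta,\zeta)\|=\|U\|_2+|\eta|+|\zeta|$; write $L^p=L^p([0,T];\mathbb R^{m\times n}\times\mathbb R\times\mathbb R)$, similarly $L^\infty$. Assume: (A1) $\mathcal R:\mathbb R^n\to\mathbb R$ is convex, with subdifferential $\partial\mathcal R$; (A2) $0\in\partial\mathcal R(0)$; (A3) there is $M>0$ such that for each $x\in\mathbb R^n$ either $\sup\{\|z\|_2:z\in\partial\mathcal R(x)\}\le M\|x\|_2$ or $\sup\{\|z\|_2:z\in\partial\mathcal R(x)\}\le M$; (A4) $\mathcal L:\mathbb R^n\times\mathbb R^n\to\mathbb R$ is continuous and nonnegative; (A5) $\psi:\mathbb R\to[0,+\infty)$ is locally Lipschitz continuous. Let $\mathscr D\subset L^p$ be a set of triples $(A,\alpha,\lambda)$ with $\alpha,\lambda\ge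 0$ a.e. on $[0,T]$ such that (1) $\mathscr D$ is bounded in $L^\infty$; (2) $\mathscr D$ is closed in $L^p$; (3) $\lim_{|h|\to0}\|\tau_h u-u\|_{L^p(\mathbb R)}=0$ uniformly for $u\in\mathscr D$, where $u$ is extended by $0$ outside $[0,T]$ and $(\tau_hu)(t)=u(t+h)$. For $(x^0,b,y)\in\mathbb R^n\times\mathbb R^m\times\mathbb R^n$, let $(\mathfrak Q)$ be the problem of minimizing, over $(A,\alpha,\lambda)\in\mathscr D$, $$\mathcal J(A,\alpha,\lambda)=\mathcal L(x(T);y)+\beta_1\psi\Big(\tfrac1T\int_0^T\|A(t)\|_2^p\,dt\Big)+\beta_2\psi\Big(\tfrac1T\int_0^T|\alpha(t)|^p\,dt\Big)+\beta_3\psi\Big(\tfrac1T\int_0^T|\lambda(t)|^p\,dt\Big)$$ subject to: $x:[0,T]\to\mathbb R^n$ is absolutely continuous, $x(0)=x^0$, and $$0\in\dot x(t)+\alpha(t)A(t)^\top(A(t)x(t)-b)+\alpha(t)\lambda(t)\,\partial\mathcal R(x(t))\quad\text{for a.e. }t\in[0,T].$$ Let $S$ be its solution set (the set of minimizing $(A,\alpha,\lambda)\in\mathscr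 D$). \textbf{Theorem} (stability of the learning problem of the deep-layer limit system w.r.t. $(x^0,b,y)$). Let $((x^0)^{(r)},b^{(r)},y^{(r)})\to(x^0,b,y)$ in $\mathbb R^n\times\mathbb R^m\times\mathbb R^n$ as $r\to+\infty$. For each $r$, let $(\widetilde{\mathfrak Q}^{(r)})$, with objective $\widetilde{\mathcal J}^{(r)}$ and solution set $\widetilde S^{(r)}$, be the problem $(\mathfrak Q)$ with $(x^0,b,y)$ replaced by $((x^0)^{(r)},b^{(r)},y^{(r)})$, and let $u^{(r)}=(A^{*,(r)},\alpha^{*,(r)},\lambda^{*,(r)})\in\widetilde S^{(r)}$. Then: (1) the sequence $(u^{(r)})_r$ has a subsequence converging in $L^p$, and all its cluster points in $L^p$ belong to $S$; (2) $\displaystyle\lim_{r\to+\infty}\inf_{u\in S}\|u^{(r)}-u\|_{L^p}=0$; (3) the optimal values converge: $\displaystyle\inf_{u\in\mathscr D}\widetilde{\mathcal J}^{(r)}(u)\to\inf_{u\in\mathscr D}\mathcal J(u)$ as $r\to+\infty$. -/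

import Mathlib

open MeasureTheory Set Filter Topology
open scoped ENNReal NNReal Matrix.Norms.L2Operator

noncomputable section

namespace FBSLimit

/-- `ℝⁿ` with the Euclidean norm. -/
abbrev Vec (n : ℕ) : Type := EuclideanSpace ℝ (Fin n)

/-- `ℝ^{m × n}`; as a normed space it carries the spectral norm `‖·‖₂`. -/
abbrev Mat (m n : ℕ) : Type := Matrix (Fin m) (Fin n) ℝ

/-- The parameter space `ℝ^{m × n} × ℝ × ℝ` with the norm `‖(U, η, ζ)‖ = ‖U‖₂ + |η| + |ζ|`. -/
abbrev Param (m n : ℕ) : Type := WithLp 1 (Mat m n × WithLp 1 (ℝ × ℝ))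

/-- The component `A` of a parameter triple `(A, α, λ)`. -/
def Param.A {m n : ℕ} (w : Param m n) : Mat m n := w.fst

/-- The component `α` of a parameter triple `(A, α, λ)`. -/
def Param.α {m n : ℕ} (w : Param m n) : ℝ := w.snd.fst

/-- The component `λ` of a parameter triple `(A, α, λ)`. -/
def Param.lam {m n : ℕ} (w : Param m n) : ℝ := w.snd.snd

/-- The norm of the parameter space is the sum of the three norms. -/
theorem Param.norm_eq {m n : ℕ} (w : Param m n) :
    ‖w‖ = ‖Param.A w‖ + |Param.α w| + |Param.lam w| := by
  rw [WithLp.prod_norm_eq_of_L1, WithLp.prod_norm_eq_of_L1, ← add_assoc]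
  rfl

/-- Lebesgue measure on the time interval `[0, T]`. -/
abbrev timeMeasure (T : ℝ) : Measure ℝ := volume.restrict (Icc 0 T)

/-- The space `L^p([0, T]; ℝ^{m × n} × ℝ × ℝ)` of controls `(A, α, λ)`. -/
abbrev Control (m n : ℕ) (p : ℝ≥0∞) (T : ℝ) : Type := Lp (Param m n) p (timeMeasure T)

/-- The subdifferential of a function `R : ℝⁿ → ℝ` at `x`, in the sense of convex analysis. -/
def subdifferential {n : ℕ} (R : Vec n → ℝ) (x : Vec n) : Set (Vec n) :=
  {g | ∀ w : Vec n, R x + inner ℝ g (w - x) ≤ R w}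

/-- The extension of a control by zero outside `[0, T]`. -/
def extendZero {m n : ℕ} {p : ℝ≥0∞} {T : ℝ} (u : Control m n p T) : ℝ → Param m n :=
  (Icc 0 T).indicator u

/-- Boundedness of a set of controls in `L^∞([0, T])`. -/
def BoundedLinfty {m n : ℕ} {p : ℝ≥0∞} {T : ℝ} (D : Set (Control m n p T)) : Prop :=
  ∃ C : ℝ, ∀ u ∈ D, ∀ᵐ t ∂(timeMeasure T), ‖u t‖ ≤ C

/-- Equi-continuity in the `L^p` sense: `‖τ_h u - u‖_{L^p(ℝ)} → 0` as `h → 0`, uniformly for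
`u ∈ D`, where `(τ_h u)(t) = u (t + h)` and `u` is extended by zero to `ℝ`. -/
def EquicontinuousLp {m n : ℕ} {p : ℝ≥0∞} {T : ℝ} (D : Set (Control m n p T)) : Prop :=
  ∀ ε : ℝ≥0∞, 0 < ε → ∃ δ : ℝ, 0 < δ ∧ ∀ h : ℝ, |h| < δ → ∀ u ∈ D,
    eLpNorm (fun t => extendZero u (t + h) - extendZero u t) p volume < ε

/-- `x` is an absolutely continuous solution on `[0, T]` of the differential inclusion
`0 ∈ x'(t) + α(t) A(t)ᵀ (A(t) x(t) - b) + α(t) λ(t) ∂R(x(t))` for a.e. `t`, with `x(0) = x⁰`. -/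
structure IsState {m n : ℕ} {p : ℝ≥0∞} {T : ℝ} (R : Vec n → ℝ) (x₀ : Vec n) (b : Vec m)
    (u : Control m n p T) (x : ℝ → Vec n) : Prop where
  absCont : AbsolutelyContinuousOnInterval x 0 T
  init : x 0 = x₀
  inclusion : ∀ᵐ t ∂(timeMeasure T), ∃ v : Vec n, HasDerivAt x v t ∧
    ∃ g ∈ subdifferential R (x t),
      v + Param.α (u t) • Matrix.toEuclideanLin (Param.A (u t)).transpose
            (Matrix.toEuclideanLin (Param.A (u t)) (x t) - b)
        + (Param.α (u t) * Param.lam (u t)) • g = 0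

/-- The objective
`L(x(T); y) + β₁ ψ(T⁻¹ ∫ ‖A‖₂^p) + β₂ ψ(T⁻¹ ∫ |α|^p) + β₃ ψ(T⁻¹ ∫ |λ|^p)`
at a control `u = (A, α, λ)` with state `x`. -/
def objective {m n : ℕ} {p : ℝ≥0∞} {T : ℝ} (L : Vec n → Vec n → ℝ) (ψ : ℝ → ℝ)
    (β₁ β₂ β₃ : ℝ) (y : Vec n) (u : Control m n p T) (x : ℝ → Vec n) : ℝ :=
  L (x T) y
    + β₁ * ψ (T⁻¹ * ∫ t in Icc 0 T, ‖Param.A (u t)‖ ^ p.toReal)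
    + β₂ * ψ (T⁻¹ * ∫ t in Icc 0 T, |Param.α (u t)| ^ p.toReal)
    + β₃ * ψ (T⁻¹ * ∫ t in Icc 0 T, |Param.lam (u t)| ^ p.toReal)

/-- The solution set of the learning problem: the admissible controls `u ∈ D` whose state makes
the objective minimal among all admissible controls and their states. -/
def solutionSet {m n : ℕ} {p : ℝ≥0∞} {T : ℝ} (R : Vec n → ℝ) (L : Vec n → Vec n → ℝ)
    (ψ : ℝ → ℝ) (β₁ β₂ β₃ : ℝ) (D : Set (Control m n p T))
    (x₀ : Vec n) (b : Vec m) (y : Vec n) : Set (Control m n p T) :=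
  {u | u ∈ D ∧ ∃ x, IsState R x₀ b u x ∧ ∀ v ∈ D, ∀ z, IsState R x₀ b v z →
    objective L ψ β₁ β₂ β₃ y u x ≤ objective L ψ β₁ β₂ β₃ y v z}

/-- The optimal value of the learning problem: the infimum of the objective over all admissible
controls and their states. -/
def optimalValue {m n : ℕ} {p : ℝ≥0∞} {T : ℝ} (R : Vec n → ℝ) (L : Vec n → Vec n → ℝ)
    (ψ : ℝ → ℝ) (β₁ β₂ β₃ : ℝ) (D : Set (Control m n p T))
    (x₀ : Vec n) (b : Vec m) (y : Vec n) : ℝ :=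
  sInf {c | ∃ u ∈ D, ∃ x, IsState R x₀ b u x ∧ c = objective L ψ β₁ β₂ β₃ y u x}

end FBSLimit

end

/-! ### Grönwall's inequality and subdifferentials of convex functions -/

namespace FBSLimit

/-! The proof is compactness plus continuity. A set of controls that is bounded in L^∞, closed in
L^p and has uniformly small translation differences is compact in L^p
(`isCompact_of_equicontinuous_translations`), so every subsequence of the minimizers has a further
subsequence converging to some u ∈ D. The endpoint x(T) depends continuously on (x⁰, b, u)
(`tendsto_state_endpoint`), hence so does the objective, jointly with y. Letting r → ∞ in J_r(u_r) ≤
J_r(v) for a fixed competitor v shows that u is a minimizer and that the optimal values converge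
along that subsequence (`mem_solutionSet_of_tendsto`). The subsequence principle then gives all the
conclusions.

Continuity of the state rests on monotonicity of ∂R. In the derivative of ‖x - x'‖² the term with
the difference of subgradients has a favourable sign; what remains is a Lipschitz term and the
difference of the coefficients, which is controlled in L¹. Grönwall's inequality closes the estimate
(`IsApproxState.norm_sub_sq_le`).

A competitor v must also have a state for the perturbed data, so existence is needed
(`exists_state`). It comes from the explicit Euler scheme: the same comparison, with an error for
the lag between a curve and its last node, makes the Euler curves Cauchy. Their limit is identified
by an integrated variational inequality in which x' does not occur, so pointwise convergence
suffices and no weak limit of velocities is taken. -/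

theorem _root_.AbsolutelyContinuousOnInterval.norm_sq {F : Type*} [NormedAddCommGroup F]
    {z : ℝ → F} {a b : ℝ} (hz : AbsolutelyContinuousOnInterval z a b) :
    AbsolutelyContinuousOnInterval (fun t => ‖z t‖ ^ 2) a b := by
  have h : AbsolutelyContinuousOnInterval (fun t => ‖z t‖) a b := by
    apply squeeze_zero (fun t ↦ ?_) (fun t ↦ ?_) hz
    · exact Finset.sum_nonneg (fun i hi ↦ by positivity)
    · gcongr
      rw [Real.dist_eq, dist_eq_norm]
      exact abs_norm_sub_norm_le _ _
  simpa only [pow_two] using h.fun_mul h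

/-- Grönwall's inequality for absolutely continuous functions. -/
theorem gronwall_absolutelyContinuous {f δ : ℝ → ℝ} {T K : ℝ} (hK : 0 ≤ K)
    (hf : AbsolutelyContinuousOnInterval f 0 T) (hf0 : 0 ≤ f 0)
    (hδ0 : ∀ t, 0 ≤ δ t) (hδ : IntegrableOn δ (Icc 0 T))
    (hder : ∀ᵐ t ∂(timeMeasure T), deriv f t ≤ K * f t + δ t) :
    ∀ t ∈ Icc 0 T, f t ≤ (f 0 + ∫ s in Icc 0 T, δ s) * Real.exp (K * T) := by
  intro t ht
  have hsub : uIcc 0 t ⊆ uIcc 0 T := by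
    rw [uIcc_of_le ht.1, uIcc_of_le (ht.1.trans ht.2)]; exact Icc_subset_Icc le_rfl ht.2
  have hft := hf.mono hsub
  -- Integrating factor: (e^{-Ks} f)' ≤ e^{-Ks} δ ≤ δ for s ≥ 0, which is then integrated over [0,
  -- t].
  have hexp : AbsolutelyContinuousOnInterval (fun s => Real.exp (-K * s)) 0 t := by
    apply ContDiffOn.absolutelyContinuousOnInterval
    apply ContDiff.contDiffOn
    fun_prop
  have hg := hexp.fun_mul hft
  have hFTC := hg.integral_deriv_eq_sub
  have hδt : IntegrableOn δ (Icc 0 t) := hδ.mono_set (Icc_subset_Icc le_rfl ht.2)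
  have hle : ∫ s in (0 : ℝ)..t, deriv (fun s => Real.exp (-K * s) * f s) s
      ≤ ∫ s in (0 : ℝ)..t, δ s := by
    apply intervalIntegral.integral_mono_ae_restrict ht.1 hg.intervalIntegrable_deriv
    · rw [intervalIntegrable_iff_integrableOn_Icc_of_le ht.1]; exact hδt
    · have h1 : ∀ᵐ s ∂(volume.restrict (Icc 0 t)), deriv f s ≤ K * f s + δ s :=
        ae_restrict_of_ae_restrict_of_subset (Icc_subset_Icc le_rfl ht.2) hder
      have h2 := ae_restrict_of_ae (s := Icc 0 t) hft.ae_differentiableAt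
      have h3 := ae_restrict_mem (μ := (volume : Measure ℝ)) (s := Icc 0 t) measurableSet_Icc
      filter_upwards [h1, h2, h3] with s hs1 hs2 hs3
      have hd := (hs2 (by rwa [uIcc_of_le ht.1])).hasDerivAt
      have he : HasDerivAt (fun s => Real.exp (-K * s)) (Real.exp (-K * s) * (-K)) s := by
        simpa using ((hasDerivAt_id s).const_mul (-K)).exp
      rw [(he.fun_mul hd).deriv]
      have hpos := Real.exp_pos (-K * s)
      have hle1 : Real.exp (-K * s) ≤ 1 := by
        rw [Real.exp_le_one_iff]; nlinarith [hs3.1]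
      nlinarith [hδ0 s, mul_le_mul_of_nonneg_left hs1 hpos.le]
  have hI : ∫ s in (0 : ℝ)..t, δ s ≤ ∫ s in Icc 0 T, δ s := by
    rw [intervalIntegral.integral_of_le ht.1, ← integral_Icc_eq_integral_Ioc]
    exact setIntegral_mono_set hδ (ae_of_all _ hδ0)
      (Icc_subset_Icc le_rfl ht.2).eventuallyLE
  rw [hFTC] at hle
  simp only [mul_zero, Real.exp_zero, one_mul] at hle
  have hb : Real.exp (-K * t) * f t ≤ f 0 + ∫ s in Icc 0 T, δ s := by linarith
  have hI0 : 0 ≤ ∫ s in Icc 0 T, δ s := integral_nonneg hδ0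
  calc f t = Real.exp (K * t) * (Real.exp (-K * t) * f t) := by
        rw [← mul_assoc, ← Real.exp_add]; simp
    _ ≤ Real.exp (K * t) * (f 0 + ∫ s in Icc 0 T, δ s) := by gcongr
    _ ≤ Real.exp (K * T) * (f 0 + ∫ s in Icc 0 T, δ s) := by
        have := ht.2
        gcongr
    _ = _ := mul_comm _ _

/-- Hahn–Banach separates (x, R x) from the strict epigraph, which is open because a finite convex
function on ℝⁿ is continuous. The separating hyperplane is not vertical (κ < 0), so it is the graph
of an affine minorant; its slope is the subgradient. -/
theorem subdifferential_nonempty {n : ℕ} {R : Vec n → ℝ} (hR : ConvexOn ℝ univ R) (x : Vec n) :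
    (subdifferential R x).Nonempty := by
  have hc : Continuous R := by
    rw [← continuousOn_univ]; exact hR.continuousOn isOpen_univ
  have hconv := hR.convex_strict_epigraph
  have hopen : IsOpen {p : Vec n × ℝ | p.1 ∈ univ ∧ R p.1 < p.2} := by
    simp only [mem_univ, true_and]
    exact isOpen_lt (hc.comp continuous_fst) continuous_snd
  obtain ⟨f, hf⟩ := geometric_hahn_banach_open_point hconv hopen (x := (x, R x)) (by simp)
  have hsplit : ∀ w s, f (w, s) = f (w, 0) + s * f (0, 1) := by
    intro w s
    have : ((w, s) : Vec n × ℝ) = (w, 0) + s • ((0 : Vec n), (1 : ℝ)) := by simp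
    rw [this, map_add, map_smul, smul_eq_mul]
  set κ := f (0, 1)
  have hκ : κ < 0 := by
    have := hf (x, R x + 1) (by simp)
    rw [hsplit x (R x + 1), hsplit x (R x)] at this
    linarith
  let φ : Vec n →L[ℝ] ℝ := f.comp (ContinuousLinearMap.inl ℝ (Vec n) ℝ)
  have hφ : ∀ w, f (w, 0) = φ w := fun w => by simp [φ]
  refine ⟨(-κ)⁻¹ • (InnerProductSpace.toDual ℝ (Vec n)).symm φ, fun w => ?_⟩
  rw [real_inner_smul_left, InnerProductSpace.toDual_symm_apply, map_sub]
  have key : ∀ s, R w < s → φ w - φ x ≤ (-κ) * (s - R x) := by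
    intro s hs
    have := hf (w, s) (by simpa using hs)
    rw [hsplit w s, hsplit x (R x), hφ, hφ] at this
    linarith
  -- The epigraph is strict, so the height R w is only reached in the limit from above.
  have key2 : φ w - φ x ≤ (-κ) * (R w - R x) := by
    apply le_of_forall_pos_le_add
    intro e he
    have := key (R w + e / (-κ)) (by have : 0 < e / (-κ) := div_pos he (by linarith)
                                     linarith)
    have h2 : -κ * (R w + e / -κ - R x) = -κ * (R w - R x) + e := by
      rw [show -κ * (R w + e / -κ - R x) = -κ * (R w - R x) + -κ * (e / -κ) by ring,
        mul_div_cancel₀ _ (by linarith : -κ ≠ 0)]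
    linarith
  have : (-κ)⁻¹ * (φ w - φ x) ≤ R w - R x := by
    rw [inv_mul_le_iff₀ (by linarith)]; exact key2
  linarith

theorem inner_sub_subdifferential_nonneg {n : ℕ} {R : Vec n → ℝ} {x y g h : Vec n}
    (hg : g ∈ subdifferential R x) (hh : h ∈ subdifferential R y) :
    0 ≤ inner ℝ (x - y) (g - h) := by
  have h1 := hg y
  have h2 := hh x
  rw [real_inner_comm, inner_sub_left]
  rw [← neg_sub x y, inner_neg_right] at h1
  linarith

end FBSLimit

/-! ### Comparison and a priori bounds for the differential inclusion -/

namespace FBSLimit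

/-- Coefficients of the inclusion `0 ∈ x'(t) + a(t, x(t)) + c(t) ∂R(x(t))`: `a` is measurable in
time, Lipschitz in space and of linear growth, and `c` is measurable, nonnegative and bounded. -/
structure IsField {n : ℕ} (K : ℝ) (a : ℝ → Vec n → Vec n) (c : ℝ → ℝ) : Prop where
  lip : ∀ t x y, ‖a t x - a t y‖ ≤ K * ‖x - y‖
  zero_le : ∀ t, ‖a t 0‖ ≤ K
  meas : ∀ z, StronglyMeasurable fun t => a t z
  c_nonneg : ∀ t, 0 ≤ c t
  c_le : ∀ t, c t ≤ K
  c_meas : Measurable c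

/-- Approximate solutions of `0 ∈ x'(t) + a(t, x(t)) + c(t) ∂R(x(t))`: the right-hand side is
evaluated along a curve `ξ` that stays within `ε` of `x`. -/
structure IsApproxState {n : ℕ} (R : Vec n → ℝ) (T : ℝ) (a : ℝ → Vec n → Vec n) (c : ℝ → ℝ)
    (ε : ℝ) (x ξ : ℝ → Vec n) : Prop where
  absCont : AbsolutelyContinuousOnInterval x 0 T
  incl : ∀ᵐ t ∂(timeMeasure T), ∃ v : Vec n, HasDerivAt x v t ∧
    ∃ g ∈ subdifferential R (ξ t), v + a t (ξ t) + c t • g = 0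
  close : ∀ t ∈ Icc 0 T, ‖x t - ξ t‖ ≤ ε

section

variable {n : ℕ} {R : Vec n → ℝ} {T K : ℝ} {a a' : ℝ → Vec n → Vec n} {c c' : ℝ → ℝ}
  {ε ε' : ℝ} {x x' ξ ξ' : ℝ → Vec n}

theorem IsField.K_nonneg (h : IsField K a c) : 0 ≤ K := (h.c_nonneg 0).trans (h.c_le 0)

theorem IsField.norm_le (h : IsField K a c) (t : ℝ) (z : Vec n) : ‖a t z‖ ≤ K * (1 + ‖z‖) := by
  have h1 := h.lip t z 0
  have h2 := h.zero_le t
  have h3 := norm_sub_norm_le (a t z) (a t 0)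
  rw [sub_zero] at h1
  linarith

theorem IsField.norm_velocity_le (h : IsField K a c) {M : ℝ}
    (hR : ∀ z, ∀ g ∈ subdifferential R z, ‖g‖ ≤ M * (1 + ‖z‖))
    {t : ℝ} {z v g : Vec n} (hg : g ∈ subdifferential R z) (hv : v + a t z + c t • g = 0) :
    ‖v‖ ≤ K * (1 + M) * (1 + ‖z‖) := by
  have hv' : v = -(a t z + c t • g) := by
    rw [eq_neg_iff_add_eq_zero, ← add_assoc]; exact hv
  have h1 := h.norm_le t z
  have h2 : ‖c t • g‖ ≤ K * (M * (1 + ‖z‖)) := by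
    rw [norm_smul, Real.norm_of_nonneg (h.c_nonneg t)]
    have := h.K_nonneg
    gcongr
    · exact h.c_le t
    · exact hR z g hg
  rw [hv', norm_neg]
  calc _ ≤ _ := norm_add_le _ _
    _ ≤ _ := add_le_add h1 h2
    _ = _ := by ring

/-- The one-sided Lipschitz estimate behind the comparison of two solutions. -/
theorem inner_sub_velocity_le {t B G η : ℝ} {z z' v v' g g' : Vec n}
    (ha : ‖a t z - a t z'‖ ≤ K * ‖z - z'‖) (hc : 0 ≤ c t)
    (hg : g ∈ subdifferential R z) (hg' : g' ∈ subdifferential R z')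
    (hv : v + a t z + c t • g = 0) (hv' : v' + a' t z' + c' t • g' = 0)
    (hz : ‖z‖ ≤ B) (hz' : ‖z'‖ ≤ B) (hG : ‖g'‖ ≤ G)
    (hη : ‖a t z' - a' t z'‖ + |c t - c' t| * G ≤ η) :
    inner ℝ (z - z') (v - v') ≤ K * ‖z - z'‖ ^ 2 + 2 * B * η := by
  have hvv : v - v' = -(a t z - a t z') - ((a t z' - a' t z') + (c t - c' t) • g')
      - c t • (g - g') := by
    have e1 : v = -(a t z + c t • g) := by rw [eq_neg_iff_add_eq_zero, ← add_assoc]; exact hv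
    have e2 : v' = -(a' t z' + c' t • g') := by
      rw [eq_neg_iff_add_eq_zero, ← add_assoc]; exact hv'
    rw [e1, e2]; module
  have h1 : inner ℝ (z - z') (-(a t z - a t z')) ≤ K * ‖z - z'‖ ^ 2 := by
    calc _ ≤ ‖z - z'‖ * ‖-(a t z - a t z')‖ := real_inner_le_norm _ _
      _ ≤ ‖z - z'‖ * (K * ‖z - z'‖) := by rw [norm_neg]; gcongr
      _ = _ := by ring
  have h2 : -inner ℝ (z - z') ((a t z' - a' t z') + (c t - c' t) • g') ≤ 2 * B * η := by
    rw [← inner_neg_right]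
    have e1 : ‖(a t z' - a' t z') + (c t - c' t) • g'‖ ≤ η := by
      refine (norm_add_le _ _).trans (le_trans ?_ hη)
      rw [norm_smul, Real.norm_eq_abs]
      gcongr
    have e2 : ‖z - z'‖ ≤ 2 * B := (norm_sub_le _ _).trans (by linarith)
    calc _ ≤ ‖z - z'‖ * ‖-((a t z' - a' t z') + (c t - c' t) • g')‖ := real_inner_le_norm _ _
      _ ≤ 2 * B * η := by
        rw [norm_neg]
        have := norm_nonneg (z - z')
        gcongr
        linarith
  have h3 : 0 ≤ inner ℝ (z - z') (c t • (g - g')) := by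
    rw [real_inner_smul_right]
    exact mul_nonneg hc (inner_sub_subdifferential_nonneg hg hg')
  rw [hvv, inner_sub_right, inner_sub_right]
  linarith

/-- Monotonicity acts on ξ - ξ', where the subgradients are taken, while Grönwall needs x - x'. The
two differ by at most ρ = ε + ε', which costs 2Vρ against the velocities and turns K‖ξ - ξ'‖² into
2K‖x - x'‖² + 2Kρ². One estimate serves two purposes: ε = ε' = 0 compares exact solutions for
different coefficients, and η = 0 compares Euler curves for the same ones. -/
theorem IsApproxState.norm_sub_sq_le (hT : 0 ≤ T) (hF : IsField K a c)
    (h : IsApproxState R T a c ε x ξ) (h' : IsApproxState R T a' c' ε' x' ξ')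
    {B G V : ℝ} {η : ℝ → ℝ} (hB : 0 ≤ B)
    (hξ : ∀ t ∈ Icc 0 T, ‖ξ t‖ ≤ B) (hξ' : ∀ t ∈ Icc 0 T, ‖ξ' t‖ ≤ B)
    (hG : ∀ z, ‖z‖ ≤ B → ∀ g ∈ subdifferential R z, ‖g‖ ≤ G)
    (hV : ∀ᵐ t ∂(timeMeasure T), ‖deriv x t‖ ≤ V)
    (hV' : ∀ᵐ t ∂(timeMeasure T), ‖deriv x' t‖ ≤ V) (hV0 : 0 ≤ V)
    (hη0 : ∀ t, 0 ≤ η t) (hηi : IntegrableOn η (Icc 0 T))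
    (hη : ∀ᵐ t ∂(timeMeasure T), ∀ z, ‖z‖ ≤ B → ‖a t z - a' t z‖ + |c t - c' t| * G ≤ η t) :
    ∀ t ∈ Icc 0 T, ‖x t - x' t‖ ^ 2 ≤ (‖x 0 - x' 0‖ ^ 2 + (4 * B * (∫ s in Icc 0 T, η s)
      + T * (4 * V * (ε + ε') + 4 * K * (ε + ε') ^ 2))) * Real.exp (4 * K * T) := by
  set ρ := ε + ε' with hρ
  have hK := hF.K_nonneg
  have hρ0 : 0 ≤ ρ := add_nonneg ((norm_nonneg _).trans (h.close 0 ⟨le_rfl, hT⟩))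
    ((norm_nonneg _).trans (h'.close 0 ⟨le_rfl, hT⟩))
  set C := 4 * V * ρ + 4 * K * ρ ^ 2 with hC
  have hC0 : 0 ≤ C := by positivity
  have hCi : IntegrableOn (fun _ : ℝ => C) (Icc 0 T) := by simp
  have hint : ∫ s in Icc 0 T, (4 * B * η s + C) = 4 * B * (∫ s in Icc 0 T, η s) + T * C := by
    rw [integral_add (hηi.const_mul _) hCi, integral_const_mul]
    simp [hT]
  rw [← hint]
  refine gronwall_absolutelyContinuous (f := fun t => ‖x t - x' t‖ ^ 2) (by positivity)
    (h.absCont.fun_sub h'.absCont).norm_sq (by positivity)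
    (fun t => by have := hη0 t; positivity) ((hηi.const_mul _).add hCi) ?_
  filter_upwards [h.incl, h'.incl, hV, hV', hη, ae_restrict_mem measurableSet_Icc]
    with t ⟨v, hv, g, hg, hvg⟩ ⟨v', hv', g', hg', hvg'⟩ hVt hVt' hηt ht
  rw [hv.deriv] at hVt
  rw [hv'.deriv] at hVt'
  have hd := ((hv.sub hv').norm_sq).deriv
  have hd' : deriv (fun t => ‖x t - x' t‖ ^ 2) t = 2 * inner ℝ (x t - x' t) (v - v') := by
    simpa using hd
  rw [hd']
  have key := inner_sub_velocity_le (hF.lip t (ξ t) (ξ' t)) (hF.c_nonneg t) hg hg' hvg hvg'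
    (hξ t ht) (hξ' t ht) (hG _ (hξ' t ht) g' hg') (hηt _ (hξ' t ht))
  have he : ‖(x t - ξ t) - (x' t - ξ' t)‖ ≤ ρ :=
    (norm_sub_le _ _).trans (add_le_add (h.close t ht) (h'.close t ht))
  set e := (x t - ξ t) - (x' t - ξ' t) with hedef
  have hsplit : x t - x' t = (ξ t - ξ' t) + e := by rw [hedef]; abel
  have h2 : inner ℝ e (v - v') ≤ ρ * (2 * V) := by
    refine (real_inner_le_norm _ _).trans ?_
    have : ‖v - v'‖ ≤ 2 * V := (norm_sub_le _ _).trans (by linarith)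
    gcongr
  have h3 : ‖ξ t - ξ' t‖ ≤ ‖x t - x' t‖ + ρ := by
    have : ξ t - ξ' t = (x t - x' t) - e := by rw [hsplit]; abel
    rw [this]
    exact (norm_sub_le _ _).trans (by linarith)
  have h4 : ‖ξ t - ξ' t‖ ^ 2 ≤ 2 * ‖x t - x' t‖ ^ 2 + 2 * ρ ^ 2 := by
    have := pow_le_pow_left₀ (norm_nonneg _) h3 2
    nlinarith [sq_nonneg (‖x t - x' t‖ - ρ)]
  have h5 : inner ℝ (x t - x' t) (v - v') = inner ℝ (ξ t - ξ' t) (v - v') + inner ℝ e (v - v') := by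
    rw [hsplit, inner_add_left]
  rw [h5]
  have h6 := mul_le_mul_of_nonneg_left h4 hK
  rw [hC]
  linarith

/-- A priori bound for solutions. -/
theorem IsApproxState.norm_sq_le (hT : 0 ≤ T) (hF : IsField K a c)
    (h : IsApproxState R T a c 0 x x) {M : ℝ} (hM : 0 ≤ M)
    (hR : ∀ z, ∀ g ∈ subdifferential R z, ‖g‖ ≤ M * (1 + ‖z‖)) :
    ∀ t ∈ Icc 0 T, ‖x t‖ ^ 2 ≤ (‖x 0‖ ^ 2 + T * (K * (1 + M)))
      * Real.exp (3 * (K * (1 + M)) * T) := by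
  have hK := hF.K_nonneg
  set C := K * (1 + M) with hC
  have hC0 : 0 ≤ C := by positivity
  have hCi : IntegrableOn (fun _ : ℝ => C) (Icc 0 T) := by simp
  have hint : ∫ s in Icc 0 T, C = T * C := by simp [hT]
  rw [← hint]
  refine gronwall_absolutelyContinuous (f := fun t => ‖x t‖ ^ 2) (by positivity)
    h.absCont.norm_sq (by positivity) (fun t => hC0) hCi ?_
  filter_upwards [h.incl] with t ⟨v, hv, g, hg, hvg⟩
  have hd' : deriv (fun t => ‖x t‖ ^ 2) t = 2 * inner ℝ (x t) v := by
    simpa using hv.norm_sq.deriv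
  rw [hd']
  have h1 := hF.norm_velocity_le hR hg hvg
  have h2 : inner ℝ (x t) v ≤ ‖x t‖ * (C * (1 + ‖x t‖)) :=
    (real_inner_le_norm _ _).trans (by gcongr)
  -- With r = ‖x t‖, the inequality 2r ≤ 1 + r² gives 2Cr(1 + r) ≤ 3Cr² + C, hence the rate 3C and
  -- the source C.
  nlinarith [mul_nonneg hC0 (sq_nonneg (‖x t‖ - 1))]

end

end FBSLimit

/-! ### The explicit Euler scheme -/

namespace FBSLimit

section

variable {n : ℕ} {R : Vec n → ℝ} {T K : ℝ} {a : ℝ → Vec n → Vec n} {c : ℝ → ℝ}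

theorem IsField.stronglyMeasurable_comp (hF : IsField K a c) {ξ : ℝ → Vec n}
    (hξ : Measurable ξ) : StronglyMeasurable fun t => a t (ξ t) := by
  have hu : StronglyMeasurable (Function.uncurry fun (z : Vec n) (t : ℝ) => a t z) := by
    apply stronglyMeasurable_uncurry_of_continuous_of_stronglyMeasurable
    · intro t
      exact (LipschitzWith.of_dist_le_mul (K := ⟨K, hF.K_nonneg⟩) fun x y => by
        rw [dist_eq_norm, dist_eq_norm]; exact hF.lip t x y).continuous
    · exact hF.meas
  exact hu.comp_measurable (hξ.prodMk measurable_id)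

/-- The nodes of the explicit Euler scheme with step `h`. -/
noncomputable def eulerNode (a : ℝ → Vec n → Vec n) (c : ℝ → ℝ) (g : Vec n → Vec n) (x₀ : Vec n)
    (h : ℝ) : ℕ → Vec n
  | 0 => x₀
  | i + 1 => eulerNode a c g x₀ h i - ∫ s in (i * h)..((i + 1 : ℕ) * h),
      (a s (eulerNode a c g x₀ h i) + c s • g (eulerNode a c g x₀ h i))

/-- Linear growth gives 1 + ‖X (i+1)‖ ≤ (1 + ‖X i‖)(1 + Ch), so the nodes stay below B whatever the
step. Velocities are then at most CB, and the curve is within CBh of its last node, which is the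
value of ξ. -/
theorem exists_euler (hT : 0 ≤ T) (hF : IsField K a c) {M : ℝ} (hM : 0 ≤ M)
    (hR : ∀ z, ∀ g ∈ subdifferential R z, ‖g‖ ≤ M * (1 + ‖z‖))
    {g : Vec n → Vec n} (hg : ∀ z, g z ∈ subdifferential R z) (x₀ : Vec n)
    {C B : ℝ} (hC : C = K * (1 + M)) (hB : B = (1 + ‖x₀‖) * Real.exp (C * T))
    {h : ℝ} (hh : 0 < h) :
    ∃ x ξ : ℝ → Vec n, x 0 = x₀ ∧ Measurable ξ ∧ (∀ t ∈ Icc 0 T, ‖ξ t‖ ≤ B) ∧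
      (∀ᵐ t ∂(timeMeasure T), ‖deriv x t‖ ≤ C * B) ∧
      (∀ s ∈ Icc 0 T, ∀ t ∈ Icc 0 T, ‖x t - x s‖ ≤ C * B * |t - s|) ∧
      IsApproxState R T a c (C * B * h) x ξ := by
  have hK := hF.K_nonneg
  have hC0 : 0 ≤ C := by rw [hC]; positivity
  have hB0 : 0 ≤ B := by rw [hB]; positivity
  set X := eulerNode a c g x₀ h with hX
  have hstep : ∀ t z, ‖a t z + c t • g z‖ ≤ C * (1 + ‖z‖) := by
    intro t z
    rw [hC]
    have := hF.norm_velocity_le (t := t) hR (hg z)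
      (v := -(a t z + c t • g z)) (by module)
    rwa [norm_neg] at this
  have hXb : ∀ i : ℕ, 1 + ‖X i‖ ≤ (1 + ‖x₀‖) * Real.exp (C * (i * h)) := by
    intro i
    induction i with
    | zero => simp [hX, eulerNode]
    | succ i ih =>
      have h1 : ‖∫ s in (i * h)..((i + 1 : ℕ) * h), (a s (X i) + c s • g (X i))‖
          ≤ C * (1 + ‖X i‖) * |(i + 1 : ℕ) * h - i * h| :=
        intervalIntegral.norm_integral_le_of_norm_le_const fun s _ => hstep s (X i)
      have h2 : |((i + 1 : ℕ) : ℝ) * h - i * h| = h := by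
        push_cast; rw [show ((i : ℝ) + 1) * h - i * h = h by ring, abs_of_pos hh]
      rw [h2] at h1
      have h3 : ‖X (i + 1)‖ ≤ ‖X i‖ + C * (1 + ‖X i‖) * h := by
        have : X (i + 1) = X i - ∫ s in (i * h)..((i + 1 : ℕ) * h), (a s (X i) + c s • g (X i)) :=
          rfl
        rw [this]
        exact (norm_sub_le _ _).trans (by linarith)
      calc 1 + ‖X (i + 1)‖ ≤ (1 + ‖X i‖) * (C * h + 1) := by linarith
        _ ≤ ((1 + ‖x₀‖) * Real.exp (C * (i * h))) * Real.exp (C * h) := by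
          gcongr
          exact Real.add_one_le_exp _
        _ = (1 + ‖x₀‖) * Real.exp (C * ((i + 1 : ℕ) * h)) := by
          rw [mul_assoc, ← Real.exp_add]; push_cast; ring_nf
  have hfl : Measurable fun t : ℝ => ⌊t / h⌋₊ := Nat.measurable_floor.comp (measurable_id.div_const h)
  set ξ : ℝ → Vec n := fun t => X ⌊t / h⌋₊ with hξ
  have hξm : Measurable ξ := (measurable_from_nat (f := X)).comp hfl
  -- The selection g need not be measurable: ξ factors through the integer ⌊t / h⌋₊, and every
  -- function on ℕ is measurable.
  have hgm : Measurable fun t => g (ξ t) := (measurable_from_nat (f := fun i => g (X i))).comp hfl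
  set F : ℝ → Vec n := fun t => a t (ξ t) + c t • g (ξ t) with hFdef
  have hFm : StronglyMeasurable F :=
    (hF.stronglyMeasurable_comp hξm).add (hF.c_meas.stronglyMeasurable.smul hgm.stronglyMeasurable)
  have hξb : ∀ t, 1 + ‖ξ t‖ ≤ (1 + ‖x₀‖) * Real.exp (C * |t|) := by
    intro t
    refine (hXb _).trans ?_
    gcongr
    -- For t < 0 the natural floor is 0 and ξ is x₀, so the bound holds on all of ℝ and F is locally
    -- integrable there.
    rcases le_or_gt 0 t with ht | ht
    · rw [abs_of_nonneg ht]
      exact (le_div_iff₀ hh).mp (Nat.floor_le (by positivity))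
    · rw [Nat.floor_of_nonpos (div_nonpos_of_nonpos_of_nonneg ht.le hh.le)]
      simp
  have hξB : ∀ t ∈ Icc 0 T, 1 + ‖ξ t‖ ≤ B := by
    intro t ht
    refine (hξb t).trans ?_
    rw [hB, abs_of_nonneg ht.1]
    have := ht.2
    gcongr
  have hFb : ∀ t ∈ Icc 0 T, ‖F t‖ ≤ C * B := fun t ht =>
    (hstep t (ξ t)).trans (mul_le_mul_of_nonneg_left (hξB t ht) hC0)
  have hFi : LocallyIntegrable F := by
    have : LocallyIntegrable (fun t : ℝ => C * ((1 + ‖x₀‖) * Real.exp (C * |t|))) :=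
      Continuous.locallyIntegrable (by fun_prop)
    refine this.mono hFm.aestronglyMeasurable (ae_of_all _ fun t => ?_)
    refine ((hstep t (ξ t)).trans (mul_le_mul_of_nonneg_left (hξb t) hC0)).trans (le_abs_self _)
  have hFii : ∀ s t, IntervalIntegrable F volume s t := fun s t =>
    intervalIntegrable_iff.mpr
      ((hFi.integrableOn_isCompact isCompact_uIcc).mono_set uIoc_subset_uIcc)
  set x : ℝ → Vec n := fun t => x₀ - ∫ s in (0 : ℝ)..t, F s with hx
  have hdiff : ∀ s t, x t - x s = -∫ r in s..t, F r := by
    intro s t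
    rw [← intervalIntegral.integral_add_adjacent_intervals (hFii s 0) (hFii 0 t),
      intervalIntegral.integral_symm 0 s]
    simp only [hx]; abel
  have hnode : ∀ i : ℕ, x (i * h) = X i := by
    intro i
    induction i with
    | zero => simp [hx, hX, eulerNode]
    | succ i ih =>
      have e1 : X (i + 1) = X i - ∫ s in (i * h)..((i + 1 : ℕ) * h), (a s (X i) + c s • g (X i)) :=
        rfl
      have e2 : ∫ s in (i * h)..((i + 1 : ℕ) * h), (a s (X i) + c s • g (X i))
          = ∫ s in (i * h)..((i + 1 : ℕ) * h), F s := by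
        apply intervalIntegral.integral_congr_ae
        -- The frozen integrand agrees with F on the step except at the right endpoint, where the
        -- floor jumps.
        have hne : ∀ᵐ s : ℝ, s ≠ ((i + 1 : ℕ) : ℝ) * h := by simp [ae_iff, measure_singleton]
        filter_upwards [hne] with s hs hs'
        have hle : (i : ℝ) * h ≤ ((i + 1 : ℕ) : ℝ) * h := by push_cast; nlinarith
        rw [uIoc_of_le hle] at hs'
        have hlt : s < ((i + 1 : ℕ) : ℝ) * h := lt_of_le_of_ne hs'.2 hs
        have hfloor : ⌊s / h⌋₊ = i := by
          rw [Nat.floor_eq_iff (div_nonneg (le_trans (by positivity) hs'.1.le) hh.le)]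
          refine ⟨(le_div_iff₀ hh).mpr hs'.1.le, (div_lt_iff₀ hh).mpr ?_⟩
          exact_mod_cast hlt
        simp only [hFdef, hξ, hfloor]
      have e3 := hdiff (i * h) ((i + 1 : ℕ) * h)
      rw [e1, e2, ← ih]
      rw [sub_eq_iff_eq_add] at e3
      rw [e3]; abel
  have hlip : ∀ s ∈ Icc 0 T, ∀ t ∈ Icc 0 T, ‖x t - x s‖ ≤ C * B * |t - s| := by
    intro s hs t ht
    rw [hdiff, norm_neg]
    refine intervalIntegral.norm_integral_le_of_norm_le_const fun r hr => hFb r ?_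
    exact uIcc_subset_Icc hs ht (uIoc_subset_uIcc hr)
  have hder : ∀ᵐ t, HasDerivAt x (-F t) t := by
    filter_upwards [LocallyIntegrable.ae_hasDerivAt_integral hFi] with t ht
    exact (ht 0).const_sub x₀
  refine ⟨x, ξ, by simp [hx], hξm, fun t ht => by linarith [hξB t ht], ?_, hlip, ?_, ?_, ?_⟩
  · filter_upwards [ae_restrict_of_ae hder, ae_restrict_mem measurableSet_Icc] with t ht ht'
    rw [ht.deriv, norm_neg]
    exact hFb t ht'
  · apply LipschitzOnWith.absolutelyContinuousOnInterval (K := ⟨C * B, by positivity⟩)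
    rw [uIcc_of_le hT]
    refine LipschitzOnWith.of_dist_le_mul fun t ht s hs => ?_
    rw [dist_eq_norm, Real.dist_eq]
    exact hlip s hs t ht
  · filter_upwards [ae_restrict_of_ae hder] with t ht
    refine ⟨-F t, ht, g (ξ t), hg _, ?_⟩
    simp only [hFdef]; abel
  · intro t ht
    set i := ⌊t / h⌋₊ with hi
    have h1 : (i : ℝ) * h ≤ t := (le_div_iff₀ hh).mp (Nat.floor_le (div_nonneg ht.1 hh.le))
    have h2 : t < (i + 1) * h := (div_lt_iff₀ hh).mp (Nat.lt_floor_add_one _)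
    have h3 : ξ t = x (i * h) := (hnode i).symm
    rw [h3]
    refine (hlip (i * h) ⟨by positivity, h1.trans ht.2⟩ t ht).trans ?_
    gcongr
    rw [abs_of_nonneg (by linarith)]
    linarith

end

end FBSLimit

/-! ### Existence of states through a variational inequality -/

namespace FBSLimit

section

variable {n : ℕ} {R : Vec n → ℝ} {T K : ℝ} {a : ℝ → Vec n → Vec n} {c : ℝ → ℝ}

theorem IsField.stronglyMeasurable_test (hF : IsField K a c) (hRc : Continuous R)
    {ξ : ℝ → Vec n} (hξ : Measurable ξ) (w : Vec n) :
    StronglyMeasurable fun t => c t * (R w - R (ξ t)) - inner ℝ (a t (ξ t)) (ξ t - w) :=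
  (hF.c_meas.mul (measurable_const.sub (hRc.measurable.comp hξ))).stronglyMeasurable.sub
    ((hF.stronglyMeasurable_comp hξ).inner (𝕜 := ℝ)
      (hξ.stronglyMeasurable.sub (stronglyMeasurable_const (b := w))))

theorem IsField.exists_norm_le (hF : IsField K a c) (hRc : Continuous R) (w : Vec n) (B : ℝ) :
    ∃ A : ℝ, ∀ t z, ‖z‖ ≤ B →
      ‖c t * (R w - R z) - inner ℝ (a t z) (z - w)‖ ≤ A := by
  obtain ⟨Q, hQ⟩ := (isCompact_closedBall (0 : Vec n) B).exists_bound_of_continuousOn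
    hRc.continuousOn
  refine ⟨K * (|R w| + Q) + K * (1 + B) * (B + ‖w‖), fun t z hz => ?_⟩
  have hK := hF.K_nonneg
  have hQz := hQ z (by simpa using hz)
  have hB : 0 ≤ B := (norm_nonneg _).trans hz
  refine (norm_sub_le _ _).trans (add_le_add ?_ ?_)
  · rw [norm_mul, Real.norm_of_nonneg (hF.c_nonneg t)]
    gcongr
    · exact hF.c_le t
    · exact (norm_sub_le _ _).trans (add_le_add le_rfl hQz)
  · refine (norm_inner_le_norm _ _).trans ?_
    gcongr
    · exact (hF.norm_le t z).trans (by gcongr)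
    · exact (norm_sub_le _ _).trans (by gcongr)

/-- Integral form of the inclusion, tested against a point `w`. -/
theorem IsApproxState.norm_sub_sq_le_integral {ε V B : ℝ} {x ξ : ℝ → Vec n} (hF : IsField K a c)
    (hRc : Continuous R)
    (h : IsApproxState R T a c ε x ξ) (hξm : Measurable ξ) (hξ : ∀ t ∈ Icc 0 T, ‖ξ t‖ ≤ B)
    (hV : ∀ᵐ t ∂(timeMeasure T), ‖deriv x t‖ ≤ V) (hV0 : 0 ≤ V) (w : Vec n)
    {s t : ℝ} (hs : 0 ≤ s) (hst : s ≤ t) (ht : t ≤ T) :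
    ‖x t - w‖ ^ 2 - ‖x s - w‖ ^ 2 ≤
      ∫ r in s..t, (2 * (c r * (R w - R (ξ r)) - inner ℝ (a r (ξ r)) (ξ r - w)) + 2 * V * ε) := by
  have hsub : Icc s t ⊆ Icc 0 T := Icc_subset_Icc hs ht
  have hconst : AbsolutelyContinuousOnInterval (fun _ : ℝ => w) 0 T :=
    (LipschitzWith.const w).lipschitzOnWith.absolutelyContinuousOnInterval
  have hf : AbsolutelyContinuousOnInterval (fun r => ‖x r - w‖ ^ 2) s t := by
    refine (h.absCont.fun_sub hconst).norm_sq.mono ?_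
    rwa [uIcc_of_le hst, uIcc_of_le (hs.trans (hst.trans ht))]
  rw [← hf.integral_deriv_eq_sub]
  obtain ⟨A, hA⟩ := hF.exists_norm_le hRc w B
  apply intervalIntegral.integral_mono_ae_restrict hst hf.intervalIntegrable_deriv
  · rw [intervalIntegrable_iff_integrableOn_Icc_of_le hst]
    refine Integrable.add (Integrable.const_mul ?_ 2) (integrable_const _)
    refine Measure.integrableOn_of_bounded (M := A) (by simp)
      (hF.stronglyMeasurable_test hRc hξm w).aestronglyMeasurable ?_
    filter_upwards [ae_restrict_mem measurableSet_Icc] with r hr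
    exact hA r _ (hξ r (hsub hr))
  · filter_upwards [ae_restrict_of_ae_restrict_of_subset hsub h.incl,
      ae_restrict_of_ae_restrict_of_subset hsub hV, ae_restrict_mem measurableSet_Icc]
      with r ⟨v, hv, g, hg, hvg⟩ hVr hr
    rw [hv.deriv] at hVr
    have hd : deriv (fun r => ‖x r - w‖ ^ 2) r = 2 * inner ℝ (x r - w) v := by
      simpa using (hv.sub_const w).norm_sq.deriv
    rw [hd]
    have e1 : x r - w = (ξ r - w) + (x r - ξ r) := by abel
    have e2 : v = -(a r (ξ r)) - c r • g := by
      rw [sub_eq_add_neg, ← neg_add, eq_neg_iff_add_eq_zero, ← add_assoc]; exact hvg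
    have h1 : inner ℝ (x r - ξ r) v ≤ V * ε := by
      refine (real_inner_le_norm _ _).trans ?_
      rw [mul_comm]
      have := h.close r (hsub hr)
      gcongr
    -- The subgradient inequality at ξ r, scaled by c r ≥ 0, replaces g by values of R.
    have h2 : inner ℝ (ξ r - w) v ≤ c r * (R w - R (ξ r)) - inner ℝ (a r (ξ r)) (ξ r - w) := by
      have hsg := mul_le_mul_of_nonneg_left (hg w) (hF.c_nonneg r)
      rw [e2, inner_sub_right, inner_neg_right, real_inner_smul_right, real_inner_comm,
        real_inner_comm g]
      rw [← neg_sub (ξ r) w, inner_neg_right] at hsg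
      linarith
    rw [e1, inner_add_left]
    linarith

/-- A Lipschitz curve satisfying the integral inequality for all test points is a solution. -/
theorem isApproxState_of_integral (hT : 0 ≤ T) (hF : IsField K a c) (hR : ConvexOn ℝ univ R)
    {x : ℝ → Vec n} {V B : ℝ} (hV : 0 ≤ V)
    (hlip : ∀ s ∈ Icc 0 T, ∀ t ∈ Icc 0 T, ‖x t - x s‖ ≤ V * |t - s|)
    (hxm : Measurable x) (hxB : ∀ t ∈ Icc 0 T, ‖x t‖ ≤ B)
    (hint : ∀ w s t, 0 ≤ s → s ≤ t → t ≤ T → ‖x t - w‖ ^ 2 - ‖x s - w‖ ^ 2 ≤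
      ∫ r in s..t, 2 * (c r * (R w - R (x r)) - inner ℝ (a r (x r)) (x r - w))) :
    IsApproxState R T a c 0 x x := by
  have hRc : Continuous R := by
    rw [← continuousOn_univ]; exact hR.continuousOn isOpen_univ
  have hlip' : LipschitzOnWith ⟨V, hV⟩ x (Icc 0 T) := by
    refine LipschitzOnWith.of_dist_le_mul fun t ht s hs => ?_
    rw [dist_eq_norm, Real.dist_eq]
    exact hlip s hs t ht
  set Φ : Vec n → ℝ → ℝ :=
    fun w r => 2 * (c r * (R w - R (x r)) - inner ℝ (a r (x r)) (x r - w)) with hΦ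
  have hΦi : ∀ w, IntervalIntegrable (Φ w) volume 0 T := by
    intro w
    obtain ⟨A, hA⟩ := hF.exists_norm_le hRc w B
    rw [intervalIntegrable_iff_integrableOn_Icc_of_le hT]
    refine Integrable.const_mul ?_ 2
    refine Measure.integrableOn_of_bounded (M := A) (by simp)
      (hF.stronglyMeasurable_test hRc hxm w).aestronglyMeasurable ?_
    filter_upwards [ae_restrict_mem measurableSet_Icc] with r hr
    exact hA r _ (hxB r hr)
  -- The hypothesis says that this difference is monotone, so its derivative is nonnegative wherever
  -- it exists.
  have hmono : ∀ w, MonotoneOn (fun t => (∫ r in (0 : ℝ)..t, Φ w r) - ‖x t - w‖ ^ 2)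
      (Icc 0 T) := by
    intro w s hs t ht hst
    have h1 := hint w s t hs.1 hst ht.2
    have hsub : ∀ r ∈ Icc 0 T, uIcc 0 r ⊆ uIcc 0 T := fun r hr => by
      rw [uIcc_of_le hr.1, uIcc_of_le hT]; exact Icc_subset_Icc le_rfl hr.2
    have h2 := intervalIntegral.integral_interval_sub_left
      ((hΦi w).mono_set (hsub t ht)) ((hΦi w).mono_set (hsub s hs))
    simp only
    linarith
  refine ⟨?_, ?_, fun t _ => by simp⟩
  · apply LipschitzOnWith.absolutelyContinuousOnInterval (K := ⟨V, hV⟩)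
    rwa [uIcc_of_le hT]
  have hne0 : ∀ᵐ t : ℝ, t ≠ 0 := by simp [ae_iff, measure_singleton]
  have hneT : ∀ᵐ t : ℝ, t ≠ T := by simp [ae_iff, measure_singleton]
  -- The exceptional null set depends on the test point; a countable dense family of test points
  -- yields a common one.
  have hΦd : ∀ᵐ t, ∀ k : ℕ, t ∈ uIcc 0 T →
      HasDerivAt (fun t => ∫ r in (0 : ℝ)..t, Φ (TopologicalSpace.denseSeq (Vec n) k) r)
        (Φ (TopologicalSpace.denseSeq (Vec n) k) t) t := by
    rw [ae_all_iff]
    intro k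
    filter_upwards [(hΦi (TopologicalSpace.denseSeq (Vec n) k)).ae_hasDerivAt_integral]
      with t ht ht'
    exact ht ht' 0 left_mem_uIcc
  filter_upwards [ae_restrict_of_ae hne0, ae_restrict_of_ae hneT, ae_restrict_of_ae hΦd,
    ae_restrict_of_ae hlip'.ae_differentiableWithinAt_of_mem_real,
    ae_restrict_mem measurableSet_Icc] with t ht0 htT hd hx ht
  have hnhds : Icc 0 T ∈ 𝓝 t := Icc_mem_nhds (lt_of_le_of_ne ht.1 (Ne.symm ht0))
    (lt_of_le_of_ne ht.2 htT)
  have hv := ((hx ht).differentiableAt hnhds).hasDerivAt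
  set v := deriv x t
  refine ⟨v, hv, ?_⟩
  have huniq : UniqueDiffWithinAt ℝ (Icc 0 T) t := uniqueDiffWithinAt_of_mem_nhds hnhds
  have hdense : ∀ k : ℕ, inner ℝ (-v - a t (x t)) (TopologicalSpace.denseSeq (Vec n) k - x t)
      ≤ c t * (R (TopologicalSpace.denseSeq (Vec n) k) - R (x t)) := by
    intro k
    set w := TopologicalSpace.denseSeq (Vec n) k
    have h1 := (hd k (by rwa [uIcc_of_le hT])).sub ((hv.sub_const w).norm_sq)
    have h2 := (hmono w).derivWithin_nonneg (x := t)
    have h3 := h1.hasDerivWithinAt.derivWithin huniq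
    have h4 : 0 ≤ Φ w t - 2 * inner ℝ (x t - w) v := by
      rw [← h3]; exact h2
    rw [hΦ] at h4
    have e1 : inner ℝ (-v - a t (x t)) (w - x t)
        = inner ℝ (x t - w) v + inner ℝ (a t (x t)) (x t - w) := by
      rw [← neg_sub (x t) w, inner_neg_right, inner_sub_left, inner_neg_left,
        real_inner_comm v]
      ring
    rw [e1]
    linarith
  have hall : ∀ w, inner ℝ (-v - a t (x t)) (w - x t) ≤ c t * (R w - R (x t)) := by
    have hcl : IsClosed {w | inner ℝ (-v - a t (x t)) (w - x t) ≤ c t * (R w - R (x t))} :=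
      isClosed_le (by fun_prop) (by fun_prop)
    intro w
    refine hcl.closure_subset_iff.mpr ?_ ((TopologicalSpace.denseRange_denseSeq (Vec n)) w)
    rintro _ ⟨k, rfl⟩
    exact hdense k
  -- If c t = 0, testing with -v - a itself forces it to vanish and any subgradient will do;
  -- otherwise (-v - a) / c t is a subgradient.
  rcases (hF.c_nonneg t).eq_or_lt with hc | hc
  · obtain ⟨g, hg⟩ := subdifferential_nonempty hR (x t)
    refine ⟨g, hg, ?_⟩
    have h1 := hall (x t + (-v - a t (x t)))
    rw [← hc, zero_mul, add_sub_cancel_left] at h1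
    have h2 : -v - a t (x t) = 0 := (real_inner_self_nonpos (F := Vec n)).mp h1
    rw [← hc, zero_smul, add_zero, ← neg_eq_zero, ← h2]
    abel
  · refine ⟨(c t)⁻¹ • (-v - a t (x t)), fun w => ?_, ?_⟩
    · have h1 := hall w
      rw [real_inner_smul_left]
      have h2 : (c t)⁻¹ * inner ℝ (-v - a t (x t)) (w - x t) ≤ R w - R (x t) := by
        rwa [inv_mul_le_iff₀ hc]
      linarith
    · rw [smul_inv_smul₀ hc.ne']
      abel

/-- Euler curves with steps 1/(k+1) have common constants B and CB, so the comparison estimate with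
η = 0 makes them Cauchy at each time. Curves and last nodes share the limit, and dominated
convergence carries the integral inequality over to it. -/
theorem exists_state (hT : 0 ≤ T) (hF : IsField K a c) {M : ℝ} (hM : 0 ≤ M)
    (hR : ConvexOn ℝ univ R)
    (hRM : ∀ z, ∀ g ∈ subdifferential R z, ‖g‖ ≤ M * (1 + ‖z‖)) (x₀ : Vec n) :
    ∃ x : ℝ → Vec n, x 0 = x₀ ∧ IsApproxState R T a c 0 x x := by
  have hRc : Continuous R := by
    rw [← continuousOn_univ]; exact hR.continuousOn isOpen_univ
  choose g hg using subdifferential_nonempty hR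
  obtain ⟨C, hC⟩ : ∃ C, C = K * (1 + M) := ⟨_, rfl⟩
  obtain ⟨B, hB⟩ : ∃ B, B = (1 + ‖x₀‖) * Real.exp (C * T) := ⟨_, rfl⟩
  have hK := hF.K_nonneg
  have hC0 : 0 ≤ C := by rw [hC]; positivity
  have hB0 : 0 ≤ B := by rw [hB]; positivity
  have hV0 : 0 ≤ C * B := by positivity
  have hstep : ∀ k : ℕ, 0 < 1 / ((k : ℝ) + 1) := fun k => Nat.one_div_pos_of_nat
  choose x ξ hx0 hξm hξB hder hlip hst using fun k : ℕ =>
    exists_euler hT hF hM hRM hg x₀ hC hB (hstep k)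
  set e : ℕ → ℝ := fun k => C * B * (1 / ((k : ℝ) + 1)) with he
  have he0 : Tendsto e atTop (𝓝 0) := by
    simpa only [mul_zero] using tendsto_one_div_add_atTop_nhds_zero_nat.const_mul (C * B)
  have hcauchy : ∀ t ∈ Icc 0 T, ∃ z, Tendsto (fun k => x k t) atTop (𝓝 z) := by
    intro t ht
    apply cauchySeq_tendsto_of_complete
    have hcomp : ∀ k l, ‖x k t - x l t‖ ^ 2 ≤
        T * (4 * (C * B) * (e k + e l) + 4 * K * (e k + e l) ^ 2) * Real.exp (4 * K * T) := by
      intro k l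
      have := (hst k).norm_sub_sq_le hT hF (hst l) (G := M * (1 + B)) (η := 0) hB0 (hξB k) (hξB l)
        (fun z hz g hg => (hRM z g hg).trans (by gcongr)) (hder k) (hder l) hV0
        (fun _ => le_rfl) (by simp [Pi.zero_def]) (ae_of_all _ fun t z _ => by simp) t ht
      simpa only [hx0, sub_self, norm_zero, ne_eq, OfNat.ofNat_ne_zero, not_false_eq_true, zero_pow,
        Pi.zero_apply, integral_zero, mul_zero, zero_add] using this
    rw [Metric.cauchySeq_iff]
    intro δ hδ
    have hlim : Tendsto (fun q : ℕ × ℕ => T * (4 * (C * B) * (e q.1 + e q.2)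
        + 4 * K * (e q.1 + e q.2) ^ 2) * Real.exp (4 * K * T)) (atTop ×ˢ atTop) (𝓝 0) := by
      have h1 : Tendsto (fun q : ℕ × ℕ => e q.1 + e q.2) (atTop ×ˢ atTop) (𝓝 0) := by
        simpa using (he0.comp tendsto_fst).add (he0.comp tendsto_snd)
      have h2 : Continuous fun r : ℝ => T * (4 * (C * B) * r + 4 * K * r ^ 2) *
        Real.exp (4 * K * T) := by fun_prop
      have h3 := (h2.tendsto 0).comp h1
      simp only [mul_zero, ne_eq, OfNat.ofNat_ne_zero, not_false_eq_true, zero_pow, add_zero,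
        zero_mul] at h3
      exact h3
    rw [prod_atTop_atTop_eq] at hlim
    obtain ⟨N, hN⟩ := eventually_atTop.mp (hlim.eventually (gt_mem_nhds (pow_pos hδ 2)))
    refine ⟨max N.1 N.2, fun k hk l hl => ?_⟩
    rw [dist_eq_norm]
    refine lt_of_pow_lt_pow_left₀ 2 hδ.le ((hcomp k l).trans_lt (hN (k, l) ?_))
    exact ⟨(le_max_left _ _).trans hk, (le_max_right _ _).trans hl⟩
  choose! X hX using hcauchy
  -- The limit is only known on [0, T]; projecting time onto the interval makes Y continuous on ℝ,
  -- hence measurable.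
  set Y : ℝ → Vec n := fun t => X (projIcc 0 T hT t) with hY
  have hYt : ∀ t ∈ Icc 0 T, Tendsto (fun k => x k t) atTop (𝓝 (Y t)) := by
    intro t ht
    have : Y t = X t := by simp [hY, projIcc_of_mem hT ht]
    rw [this]; exact hX t ht
  have hξt : ∀ t ∈ Icc 0 T, Tendsto (fun k => ξ k t) atTop (𝓝 (Y t)) := by
    intro t ht
    have h1 : Tendsto (fun k => x k t - ξ k t) atTop (𝓝 0) :=
      squeeze_zero_norm (fun k => (hst k).close t ht) he0
    simpa using (hYt t ht).sub h1
  have hYB : ∀ t ∈ Icc 0 T, ‖Y t‖ ≤ B := fun t ht =>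
    le_of_tendsto (hξt t ht).norm (Eventually.of_forall fun k => hξB k t ht)
  have hYlip : ∀ s ∈ Icc 0 T, ∀ t ∈ Icc 0 T, ‖Y t - Y s‖ ≤ C * B * |t - s| := fun s hs t ht =>
    le_of_tendsto ((hYt t ht).sub (hYt s hs)).norm
      (Eventually.of_forall fun k => hlip k s hs t ht)
  have hYm : Measurable Y := by
    have : LipschitzOnWith ⟨C * B, hV0⟩ X (Icc 0 T) := by
      refine LipschitzOnWith.of_dist_le_mul fun t ht s hs => ?_
      have := hYlip s hs t ht
      simp only [hY, projIcc_of_mem hT ht, projIcc_of_mem hT hs] at this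
      rw [dist_eq_norm, Real.dist_eq]
      exact this
    exact (this.continuousOn.comp_continuous (continuous_subtype_val.comp continuous_projIcc)
      fun t => (projIcc 0 T hT t).2).measurable
  refine ⟨Y, ?_, isApproxState_of_integral hT hF hR hV0 hYlip hYm hYB ?_⟩
  · refine tendsto_nhds_unique (hYt 0 ⟨le_rfl, hT⟩) ?_
    simp [hx0]
  · intro w s t hs hst' ht
    have hmem : ∀ r ∈ uIoc s t, r ∈ Icc 0 T := fun r hr => by
      rw [uIoc_of_le hst'] at hr; exact ⟨hs.trans hr.1.le, hr.2.trans ht⟩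
    obtain ⟨A, hA⟩ := hF.exists_norm_le hRc w B
    have hlim : Tendsto (fun k => ∫ r in s..t, (2 * (c r * (R w - R (ξ k r))
        - inner ℝ (a r (ξ k r)) (ξ k r - w)) + 2 * (C * B) * e k)) atTop
        (𝓝 (∫ r in s..t, 2 * (c r * (R w - R (Y r)) - inner ℝ (a r (Y r)) (Y r - w)))) := by
      apply intervalIntegral.tendsto_integral_filter_of_dominated_convergence
        (fun _ => 2 * A + 2 * (C * B) * (C * B))
      · refine Eventually.of_forall fun k => ?_
        exact (((hF.stronglyMeasurable_test hRc (hξm k) w).measurable.const_mul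
          2).add_const _).aestronglyMeasurable
      · refine Eventually.of_forall fun k => ae_of_all _ fun r hr => ?_
        have h1 := hA r (ξ k r) (hξB k r (hmem r hr))
        refine (norm_add_le _ _).trans (add_le_add ?_ ?_)
        · rw [norm_mul]; simpa using h1
        · have : e k ≤ C * B := by
            refine mul_le_of_le_one_right hV0 ?_
            rw [div_le_one (by positivity)]
            linarith [(Nat.cast_nonneg k : (0 : ℝ) ≤ k)]
          have he' : 0 ≤ e k := mul_nonneg hV0 (hstep k).le
          rw [Real.norm_of_nonneg (by positivity)]
          gcongr
      · simp
      · refine ae_of_all _ fun r hr => ?_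
        have h1 := hξt r (hmem r hr)
        have h2 : Tendsto (fun k => R (ξ k r)) atTop (𝓝 (R (Y r))) := (hRc.tendsto _).comp h1
        have h3 : Continuous fun z => a r z :=
          (LipschitzWith.of_dist_le_mul (K := ⟨K, hK⟩) fun x y => by
            rw [dist_eq_norm, dist_eq_norm]; exact hF.lip r x y).continuous
        have h4 : Tendsto (fun k => a r (ξ k r)) atTop (𝓝 (a r (Y r))) := (h3.tendsto _).comp h1
        have h5 := ((((h2.const_sub (R w)).const_mul (c r)).sub
          (h4.inner (h1.sub_const w))).const_mul 2).add (he0.const_mul (2 * (C * B)))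
        simpa using h5
    have hsI : s ∈ Icc 0 T := ⟨hs, hst'.trans ht⟩
    have htI : t ∈ Icc 0 T := ⟨hs.trans hst', ht⟩
    refine le_of_tendsto_of_tendsto' ((((hYt t htI).sub_const w).norm.pow 2).sub
      (((hYt s hsI).sub_const w).norm.pow 2)) hlim fun k => ?_
    exact (hst k).norm_sub_sq_le_integral hF hRc (hξm k) (hξB k) (hder k) hV0 w hs hst' ht

end

end FBSLimit

/-! ### Kolmogorov–Riesz compactness in L^p on an interval -/

namespace FBSLimit

section

variable {E : Type*} [NormedAddCommGroup E]

/-- Averaged over the offset `s`, the error of sampling `f` on the grid `s + hℕ` is controlled by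
the modulus of continuity of `f` in `L^q`. -/
theorem lintegral_sampling_error_le {f : ℝ → E} (hf : StronglyMeasurable f) {q : ℝ} {T h : ℝ}
    (hh : 0 < h) {η : ℝ≥0∞}
    (hη : ∀ σ, |σ| ≤ h → ∫⁻ t, ‖f (t + σ) - f t‖ₑ ^ q ≤ η) :
    ∫⁻ s in Ioc 0 h, ∫⁻ t in Icc 0 T, ‖f (⌊t / h⌋₊ * h + s) - f t‖ₑ ^ q ≤
      ENNReal.ofReal (2 * h) * η := by
  have hfl : Measurable fun t : ℝ => (⌊t / h⌋₊ : ℝ) * h :=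
    (measurable_from_nat (f := fun i : ℕ => (i : ℝ) * h)).comp
      (Nat.measurable_floor.comp (measurable_id.div_const h))
  have hm1 : Measurable fun z : ℝ × ℝ => ‖f (⌊z.2 / h⌋₊ * h + z.1) - f z.2‖ₑ ^ q :=
    ((hf.comp_measurable ((hfl.comp measurable_snd).add measurable_fst)).sub
      (hf.comp_measurable measurable_snd)).enorm.pow_const q
  have hm2 : Measurable fun z : ℝ × ℝ => ‖f (z.1 + z.2) - f z.1‖ₑ ^ q :=
    ((hf.comp_measurable (measurable_fst.add measurable_snd)).sub
      (hf.comp_measurable measurable_fst)).enorm.pow_const q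
  rw [lintegral_lintegral_swap hm1.aemeasurable]
  calc ∫⁻ t in Icc 0 T, ∫⁻ s in Ioc 0 h, ‖f (⌊t / h⌋₊ * h + s) - f t‖ₑ ^ q
      ≤ ∫⁻ t in Icc 0 T, ∫⁻ σ in Ioc (-h) h, ‖f (t + σ) - f t‖ₑ ^ q := by
        refine setLIntegral_mono' measurableSet_Icc fun t ht => ?_
        -- Here -h < r ≤ 0, so translating by r sends offsets s ∈ (0, h] to shifts r + s ∈ (-h, h];
        -- the length 2h of that window is the constant in the bound.
        set r := (⌊t / h⌋₊ : ℝ) * h - t with hr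
        have hr1 : r ≤ 0 := by
          have := (le_div_iff₀ hh).mp (Nat.floor_le (div_nonneg ht.1 hh.le))
          linarith
        have hr2 : -h < r := by
          have := (div_lt_iff₀ hh).mp (Nat.lt_floor_add_one (t / h))
          linarith
        rw [← lintegral_indicator measurableSet_Ioc, ← lintegral_indicator measurableSet_Ioc,
          ← lintegral_add_left_eq_self ((Ioc (-h) h).indicator _) r]
        refine lintegral_mono fun s => ?_
        by_cases hs : s ∈ Ioc 0 h
        · have hs' : r + s ∈ Ioc (-h) h := ⟨by linarith [hs.1], by linarith [hs.2]⟩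
          rw [indicator_of_mem hs, indicator_of_mem hs', hr]
          ring_nf
          exact le_rfl
        · rw [indicator_of_notMem hs]; exact zero_le
    _ = ∫⁻ σ in Ioc (-h) h, ∫⁻ t in Icc 0 T, ‖f (t + σ) - f t‖ₑ ^ q :=
        lintegral_lintegral_swap hm2.aemeasurable
    _ ≤ ∫⁻ _ in Ioc (-h) h, η := by
        refine setLIntegral_mono' measurableSet_Ioc fun σ hσ => ?_
        exact (setLIntegral_le_lintegral _ _).trans (hη σ (abs_le.mpr ⟨hσ.1.le, hσ.2⟩))
    _ = ENNReal.ofReal (2 * h) * η := by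
        rw [setLIntegral_const, Real.volume_Ioc, mul_comm]; ring_nf

/-- The mean over offsets of the sampling error is at most 2η, and for almost every offset all the
countably many samples obey the bound C. Some offset outside the null set does no worse than the
mean. -/
theorem exists_sampling {f : ℝ → E} (hf : StronglyMeasurable f) {q : ℝ} {T h C : ℝ}
    (hh : 0 < h) {η : ℝ≥0∞}
    (hη : ∀ σ, |σ| ≤ h → ∫⁻ t, ‖f (t + σ) - f t‖ₑ ^ q ≤ η) (hC : ∀ᵐ t, ‖f t‖ ≤ C) :
    ∃ s : ℝ, (∀ i : ℕ, ‖f (i * h + s)‖ ≤ C) ∧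
      ∫⁻ t in Icc 0 T, ‖f (⌊t / h⌋₊ * h + s) - f t‖ₑ ^ q ≤ 2 * η := by
  have hle := lintegral_sampling_error_le (T := T) hf hh hη
  have hN : ∀ᵐ s ∂(volume.restrict (Ioc 0 h)), ∀ i : ℕ, ‖f (i * h + s)‖ ≤ C := by
    refine ae_restrict_of_ae (ae_all_iff.mpr fun i => ?_)
    exact (measurePreserving_add_left volume ((i : ℝ) * h)).quasiMeasurePreserving.ae hC
  have hμ : volume.restrict (Ioc 0 h) ≠ 0 := by
    rw [Ne, Measure.restrict_eq_zero, Real.volume_Ioc]; simpa using hh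
  have hfl : Measurable fun t : ℝ => (⌊t / h⌋₊ : ℝ) * h :=
    (measurable_from_nat (f := fun i : ℕ => (i : ℝ) * h)).comp
      (Nat.measurable_floor.comp (measurable_id.div_const h))
  have hm : Measurable fun s => ∫⁻ t in Icc 0 T, ‖f (⌊t / h⌋₊ * h + s) - f t‖ₑ ^ q :=
    Measurable.lintegral_prod_right' (f := fun z : ℝ × ℝ => ‖f (⌊z.2 / h⌋₊ * h + z.1) - f z.2‖ₑ ^ q)
      (((hf.comp_measurable ((hfl.comp measurable_snd).add measurable_fst)).sub
        (hf.comp_measurable measurable_snd)).enorm.pow_const q)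
  obtain ⟨s, hs, hs'⟩ := exists_notMem_null_le_laverage hμ hm.aemeasurable hN
  refine ⟨s, not_not.mp hs, hs'.trans ?_⟩
  rw [setLAverage_eq, Real.volume_Ioc, sub_zero]
  refine (ENNReal.div_le_div_right hle _).trans ?_
  refine ENNReal.div_le_of_le_mul ?_
  rw [ENNReal.ofReal_mul (by norm_num), ENNReal.ofReal_ofNat]
  exact le_of_eq (by ring)

variable {p : ℝ≥0∞} {T : ℝ}

/-- The step function with the value `c i` on `[i h, (i + 1) h)` for `i < N`. -/
noncomputable def stepFun {N : ℕ} (h : ℝ) (c : Fin N → E) (t : ℝ) : E :=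
  if hi : ⌊t / h⌋₊ < N then c ⟨⌊t / h⌋₊, hi⟩ else 0

theorem memLp_stepFun {N : ℕ} (h : ℝ) (c : Fin N → E) : MemLp (stepFun h c) p (timeMeasure T) := by
  have hm : StronglyMeasurable (stepFun h c) := by
    have : StronglyMeasurable fun i : ℕ => if hi : i < N then c ⟨i, hi⟩ else 0 :=
      StronglyMeasurable.of_discrete
    exact this.comp_measurable (Nat.measurable_floor.comp (measurable_id.div_const h))
  refine MemLp.of_bound hm.aestronglyMeasurable ‖c‖ (ae_of_all _ fun t => ?_)
  unfold stepFun
  split_ifs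
  · exact norm_le_pi_norm c _
  · simp

variable [NormedSpace ℝ E]

/-- Step functions on a fixed grid, as a linear map into `L^p`. -/
noncomputable def stepLp (p : ℝ≥0∞) (T h : ℝ) (N : ℕ) :
    (Fin N → E) →ₗ[ℝ] Lp E p (timeMeasure T) where
  toFun c := (memLp_stepFun h c).toLp
  map_add' c d := by
    rw [← MemLp.toLp_add]
    congr 1
    ext t
    simp only [stepFun, Pi.add_apply]
    split_ifs <;> simp
  map_smul' r c := by
    rw [RingHom.id_apply, ← MemLp.toLp_const_smul]
    congr 1
    ext t
    simp only [stepFun, Pi.smul_apply]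
    split_ifs <;> simp

/-- The Kolmogorov–Riesz criterion for bounded sets of functions on an interval. -/
theorem isCompact_of_equicontinuous_translations [FiniteDimensional ℝ E] [Fact (1 ≤ p)] (hp : p ≠ ∞)
    {D : Set (Lp E p (timeMeasure T))} {C : ℝ}
    (hC : ∀ u ∈ D, ∀ᵐ t ∂(timeMeasure T), ‖u t‖ ≤ C) (hD : IsClosed D)
    (hequi : ∀ ε : ℝ≥0∞, 0 < ε → ∃ δ : ℝ, 0 < δ ∧ ∀ h : ℝ, |h| < δ → ∀ u ∈ D,
      eLpNorm (fun t => (Icc 0 T).indicator u (t + h) - (Icc 0 T).indicator u t) p volume < ε) :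
    IsCompact D := by
  refine isCompact_iff_totallyBounded_isComplete.mpr ⟨?_, hD.isComplete⟩
  have hp1 : 1 ≤ p := Fact.out
  have hp0 : p ≠ 0 := (zero_lt_one.trans_le hp1).ne'
  set q := p.toReal with hq
  have hq1 : 1 ≤ q := by
    rw [hq, ← ENNReal.toReal_one]; exact ENNReal.toReal_mono hp hp1
  have hq0 : 0 < q := zero_lt_one.trans_le hq1
  rw [EMetric.totallyBounded_iff]
  intro ε hε
  obtain ⟨e, he0, he⟩ : ∃ e : ℝ≥0∞, 0 < e ∧ 2 * e + e ≤ ε ∧ e ≠ ∞ := by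
    refine ⟨min (ε / 3) 1, ?_, ?_, ?_⟩
    · exact lt_min (ENNReal.div_pos hε.ne' (by simp)) one_pos
    · calc 2 * min (ε / 3) 1 + min (ε / 3) 1 = 3 * min (ε / 3) 1 := by ring
        _ ≤ 3 * (ε / 3) := by gcongr; exact min_le_left _ _
        _ ≤ ε := ENNReal.mul_div_le
    · exact ne_top_of_le_ne_top ENNReal.one_ne_top (min_le_right _ _)
  obtain ⟨δ, hδ, hδD⟩ := hequi e he0
  set h := δ / 2 with hh
  have hh0 : 0 < h := by positivity
  -- The extra cell covers t = T.
  set N := ⌊T / h⌋₊ + 1 with hN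
  have hcont : Continuous (stepLp (E := E) p T h N) :=
    LinearMap.continuous_of_finiteDimensional _
  -- The grid is chosen before u, so every sampled u lands in this one compact set of step
  -- functions, compact because the coefficient space is finite-dimensional. Its finite e-net
  -- becomes a net for D.
  have hcompact : IsCompact (stepLp p T h N '' Metric.closedBall (0 : Fin N → E) |C|) :=
    (isCompact_closedBall _ _).image hcont
  obtain ⟨S, hSf, hS⟩ := EMetric.totallyBounded_iff.mp hcompact.totallyBounded e he0
  refine ⟨S, hSf, fun u hu => ?_⟩
  set f : ℝ → E := (Icc 0 T).indicator u with hf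
  have hfm : StronglyMeasurable f := (Lp.stronglyMeasurable u).indicator measurableSet_Icc
  have hfC : ∀ᵐ t, ‖f t‖ ≤ |C| := by
    filter_upwards [(ae_restrict_iff' measurableSet_Icc).mp (hC u hu)] with t ht
    by_cases h' : t ∈ Icc 0 T
    · rw [hf, indicator_of_mem h']; exact (ht h').trans (le_abs_self C)
    · rw [hf, indicator_of_notMem h']; simp
  have hη : ∀ σ, |σ| ≤ h → ∫⁻ t, ‖f (t + σ) - f t‖ₑ ^ q ≤ e ^ q := by
    intro σ hσ
    have := (hδD σ (by linarith) u hu).le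
    rw [eLpNorm_eq_lintegral_rpow_enorm_toReal hp0 hp, one_div, ENNReal.rpow_inv_le_iff hq0] at this
    exact this
  obtain ⟨s, hsC, hs⟩ := exists_sampling (T := T) hfm hh0 hη hfC
  set c : Fin N → E := fun i => f (i * h + s) with hc
  have hcC : c ∈ Metric.closedBall (0 : Fin N → E) |C| := by
    rw [mem_closedBall_zero_iff, pi_norm_le_iff_of_nonneg (abs_nonneg C)]
    exact fun i => hsC i
  obtain ⟨z, hz, hzc⟩ := mem_iUnion₂.mp (hS (mem_image_of_mem _ hcC))
  refine mem_iUnion₂.mpr ⟨z, hz, ?_⟩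
  have hdist : edist u (stepLp p T h N c) ≤ 2 * e := by
    have h1 : stepLp p T h N c = (memLp_stepFun h c).toLp := rfl
    rw [edist_comm, h1, Lp.edist_def, eLpNorm_eq_lintegral_rpow_enorm_toReal hp0 hp,
      one_div, ENNReal.rpow_inv_le_iff hq0, ENNReal.mul_rpow_of_nonneg _ _ hq0.le]
    calc _ = ∫⁻ t in Icc 0 T, ‖f (⌊t / h⌋₊ * h + s) - f t‖ₑ ^ q := by
          refine lintegral_congr_ae ?_
          filter_upwards [(memLp_stepFun (p := p) (T := T) h c).coeFn_toLp,
            ae_restrict_mem measurableSet_Icc] with t ht ht'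
          have h2 : ⌊t / h⌋₊ < N :=
            Nat.lt_succ_of_le (Nat.floor_le_floor (by have := ht'.2; gcongr))
          rw [Pi.sub_apply, ht, stepFun, dif_pos h2, hc, hf, indicator_of_mem ht']
      _ ≤ 2 * e ^ q := hs
      -- The factor 2 from averaging is absorbed in 2 ^ q because q ≥ 1.
      _ ≤ 2 ^ q * e ^ q := by
          gcongr
          calc (2 : ℝ≥0∞) = 2 ^ (1 : ℝ) := (ENNReal.rpow_one _).symm
            _ ≤ 2 ^ q := ENNReal.rpow_le_rpow_of_exponent_le (by norm_num) hq1
  calc edist u z ≤ edist u (stepLp p T h N c) + edist (stepLp p T h N c) z := edist_triangle _ _ _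
    _ < 2 * e + e := ENNReal.add_lt_add_of_le_of_lt
        (ne_top_of_le_ne_top (ENNReal.mul_ne_top (by simp) he.2) hdist) hdist hzc
    _ ≤ ε := he.1

end

end FBSLimit

/-! ### The coefficients determined by a parameter triple -/

namespace FBSLimit

section

variable {m n : ℕ}

theorem norm_toEuclideanLin_le (A : Mat m n) (x : Vec n) :
    ‖Matrix.toEuclideanLin A x‖ ≤ ‖A‖ * ‖x‖ :=
  Matrix.l2_opNorm_mulVec A x

theorem toEuclideanLin_sub_apply (A A' : Mat m n) (x : Vec n) :
    Matrix.toEuclideanLin (A - A') x = Matrix.toEuclideanLin A x - Matrix.toEuclideanLin A' x := by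
  rw [map_sub, LinearMap.sub_apply]

theorem norm_transpose_eq (A : Mat m n) : ‖A.transpose‖ = ‖A‖ := by
  rw [← Matrix.conjTranspose_eq_transpose_of_trivial, Matrix.l2_opNorm_conjTranspose]

/-- The component `A` as a continuous linear map. -/
noncomputable def Param.AL (m n : ℕ) : Param m n →L[ℝ] Mat m n :=
  LinearMap.mkContinuous
    { toFun := Param.A, map_add' := fun _ _ => rfl, map_smul' := fun _ _ => rfl } 1
    fun w => by
      rw [one_mul, Param.norm_eq]
      have := abs_nonneg (Param.α w); have := abs_nonneg (Param.lam w)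
      change ‖Param.A w‖ ≤ _
      linarith

/-- The component `α` as a continuous linear map. -/
noncomputable def Param.αL (m n : ℕ) : Param m n →L[ℝ] ℝ :=
  LinearMap.mkContinuous
    { toFun := Param.α, map_add' := fun _ _ => rfl, map_smul' := fun _ _ => rfl } 1
    fun w => by
      rw [one_mul, Param.norm_eq]
      have := norm_nonneg (Param.A w); have := abs_nonneg (Param.lam w)
      change |Param.α w| ≤ _
      linarith

/-- The component `λ` as a continuous linear map. -/
noncomputable def Param.lamL (m n : ℕ) : Param m n →L[ℝ] ℝ :=
  LinearMap.mkContinuous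
    { toFun := Param.lam, map_add' := fun _ _ => rfl, map_smul' := fun _ _ => rfl } 1
    fun w => by
      rw [one_mul, Param.norm_eq]
      have := norm_nonneg (Param.A w); have := abs_nonneg (Param.α w)
      change |Param.lam w| ≤ _
      linarith

theorem Param.norm_A_le (w : Param m n) : ‖Param.A w‖ ≤ ‖w‖ := by
  rw [Param.norm_eq]
  linarith [abs_nonneg (Param.α w), abs_nonneg (Param.lam w)]

theorem Param.abs_α_le (w : Param m n) : |Param.α w| ≤ ‖w‖ := by
  rw [Param.norm_eq]
  linarith [norm_nonneg (Param.A w), abs_nonneg (Param.lam w)]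

theorem Param.abs_lam_le (w : Param m n) : |Param.lam w| ≤ ‖w‖ := by
  rw [Param.norm_eq]
  linarith [norm_nonneg (Param.A w), abs_nonneg (Param.α w)]

/-- The smooth part `α Aᵀ (A x - b)` of the right-hand side. -/
noncomputable def paramField (b : Vec m) (w : Param m n) (x : Vec n) : Vec n :=
  Param.α w • Matrix.toEuclideanLin (Param.A w).transpose
    (Matrix.toEuclideanLin (Param.A w) x - b)

theorem norm_smul_transpose_le {s C : ℝ} {A : Mat m n} {z : Vec m} {ρ : ℝ} (hs : |s| ≤ C)
    {C' : ℝ} (hA : ‖A‖ ≤ C') (hz : ‖z‖ ≤ ρ) :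
    ‖s • Matrix.toEuclideanLin A.transpose z‖ ≤ C * (C' * ρ) := by
  rw [norm_smul, Real.norm_eq_abs]
  have hC : 0 ≤ C := (abs_nonneg _).trans hs
  have hC' : 0 ≤ C' := (norm_nonneg _).trans hA
  refine mul_le_mul hs ((norm_toEuclideanLin_le _ _).trans ?_) (norm_nonneg _) hC
  rw [norm_transpose_eq]
  gcongr

theorem norm_paramField_sub_le {C : ℝ} {w : Param m n} (hw : ‖w‖ ≤ C) (b : Vec m) (x y : Vec n) :
    ‖paramField b w x - paramField b w y‖ ≤ C * (C * (C * ‖x - y‖)) := by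
  have h1 : paramField b w x - paramField b w y = Param.α w •
      Matrix.toEuclideanLin (Param.A w).transpose (Matrix.toEuclideanLin (Param.A w) (x - y)) := by
    simp only [paramField, ← smul_sub, ← map_sub]
    congr 2
    rw [map_sub]; abel
  rw [h1]
  refine norm_smul_transpose_le ((Param.abs_α_le w).trans hw) ((Param.norm_A_le w).trans hw) ?_
  refine (norm_toEuclideanLin_le _ _).trans ?_
  gcongr
  exact (Param.norm_A_le w).trans hw

/-- The product is telescoped: α, then the outer factor Aᵀ, then the residual A x - b is exchanged,
each time with the other factors bounded by C, B and β. -/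
theorem norm_paramField_sub_param_le {C β B : ℝ} {w w' : Param m n} (hw : ‖w‖ ≤ C)
    (hw' : ‖w'‖ ≤ C) {b b' : Vec m} (hb : ‖b‖ ≤ β) {x : Vec n} (hx : ‖x‖ ≤ B) :
    ‖paramField b w x - paramField b' w' x‖ ≤
      (2 * (C * (C * B + β)) + C * (C * B)) * ‖w - w'‖ + C * (C * ‖b - b'‖) := by
  have hα : Param.α w - Param.α w' = Param.α (w - w') := rfl
  have hA : Param.A w - Param.A w' = Param.A (w - w') := rfl
  have hC : 0 ≤ C := (norm_nonneg _).trans hw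
  obtain ⟨z, hz⟩ : ∃ z, z = Matrix.toEuclideanLin (Param.A w) x - b := ⟨_, rfl⟩
  have hzn : ‖z‖ ≤ C * B + β := by
    rw [hz]
    refine (norm_sub_le _ _).trans (add_le_add ((norm_toEuclideanLin_le _ _).trans ?_) hb)
    have := (Param.norm_A_le w).trans hw
    gcongr
  have h1 : paramField b w x - paramField b' w' x =
      Param.α (w - w') • Matrix.toEuclideanLin (Param.A w).transpose z
      + Param.α w' • Matrix.toEuclideanLin (Param.A (w - w')).transpose z
      + Param.α w' • Matrix.toEuclideanLin (Param.A w').transpose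
        (Matrix.toEuclideanLin (Param.A (w - w')) x - (b - b')) := by
    rw [← hα, ← hA, Matrix.transpose_sub, toEuclideanLin_sub_apply, toEuclideanLin_sub_apply]
    have h2 : Matrix.toEuclideanLin (Param.A w) x - Matrix.toEuclideanLin (Param.A w') x - (b - b')
        = z - (Matrix.toEuclideanLin (Param.A w') x - b') := by rw [hz]; abel
    rw [h2, map_sub, paramField, paramField, ← hz]
    module
  have hB : 0 ≤ B := (norm_nonneg _).trans hx
  have e1 := norm_smul_transpose_le (Param.abs_α_le (w - w')) ((Param.norm_A_le w).trans hw) hzn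
  have e2 := norm_smul_transpose_le ((Param.abs_α_le w').trans hw') (Param.norm_A_le (w - w')) hzn
  have e3 : ‖Matrix.toEuclideanLin (Param.A (w - w')) x - (b - b')‖ ≤ ‖w - w'‖ * B + ‖b - b'‖ := by
    refine (norm_sub_le _ _).trans (add_le_add ((norm_toEuclideanLin_le _ _).trans ?_) le_rfl)
    have := Param.norm_A_le (w - w')
    gcongr
  have e4 := norm_smul_transpose_le ((Param.abs_α_le w').trans hw')
    ((Param.norm_A_le w').trans hw') e3
  rw [h1]
  refine (norm_add₃_le).trans ?_
  linarith

theorem abs_α_mul_lam_sub_le {C : ℝ} {w w' : Param m n} (hw : ‖w‖ ≤ C) (hw' : ‖w'‖ ≤ C) :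
    |Param.α w * Param.lam w - Param.α w' * Param.lam w'| ≤ 2 * C * ‖w - w'‖ := by
  have h1 : Param.α w * Param.lam w - Param.α w' * Param.lam w' =
      Param.α (w - w') * Param.lam w + Param.α w' * Param.lam (w - w') := by
    change _ = (Param.α w - Param.α w') * Param.lam w + Param.α w' * (Param.lam w - Param.lam w')
    ring
  rw [h1]
  refine (abs_add_le _ _).trans ?_
  rw [abs_mul, abs_mul]
  have e1 := mul_le_mul (Param.abs_α_le (w - w')) ((Param.abs_lam_le w).trans hw) (abs_nonneg _)
    (norm_nonneg _)
  have e2 := mul_le_mul ((Param.abs_α_le w').trans hw') (Param.abs_lam_le (w - w'))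
    (abs_nonneg _) ((norm_nonneg _).trans hw)
  linarith

theorem continuous_paramField (b : Vec m) (x : Vec n) :
    Continuous fun w : Param m n => paramField b w x := by
  refine continuous_iff_continuousAt.mpr fun w => ?_
  refine tendsto_iff_norm_sub_tendsto_zero.mpr ?_
  set C := ‖w‖ + 1
  have hlim : Tendsto (fun w' : Param m n => (2 * (C * (C * ‖x‖ + ‖b‖)) + C * (C * ‖x‖)) * ‖w' - w‖
      + C * (C * ‖b - b‖)) (𝓝 w) (𝓝 0) := by
    have : Continuous fun w' : Param m n =>
        (2 * (C * (C * ‖x‖ + ‖b‖)) + C * (C * ‖x‖)) * ‖w' - w‖ + C * (C * ‖b - b‖) := by fun_prop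
    simpa using this.tendsto w
  refine squeeze_zero' (Eventually.of_forall fun _ => norm_nonneg _) ?_ hlim
  have hev : ∀ᶠ w' : Param m n in 𝓝 w, ‖w'‖ < C :=
    continuous_norm.continuousAt.eventually_lt continuousAt_const (lt_add_one _)
  filter_upwards [hev] with w' hw'
  exact norm_paramField_sub_param_le hw'.le (lt_add_one _).le le_rfl le_rfl

/-- C ^ 3 is the Lipschitz constant, C ^ 2 * β bounds the field at 0 and C ^ 2 bounds αλ. Their sum
depends only on C and β, which keeps later estimates uniform over D and over bounded data. -/
theorem isField_of_param {C β : ℝ} {b : Vec m} (hb : ‖b‖ ≤ β) {w : ℝ → Param m n}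
    (hwm : StronglyMeasurable w)
    (hw : ∀ t, ‖w t‖ ≤ C ∧ 0 ≤ Param.α (w t) ∧ 0 ≤ Param.lam (w t)) :
    IsField (C ^ 3 + C ^ 2 * β + C ^ 2) (fun t x => paramField b (w t) x)
      (fun t => Param.α (w t) * Param.lam (w t)) := by
  have hC : 0 ≤ C := (norm_nonneg _).trans (hw 0).1
  have hβ : 0 ≤ β := (norm_nonneg _).trans hb
  refine ⟨fun t x y => ?_, fun t => ?_, fun z => ?_, fun t => ?_, fun t => ?_, ?_⟩
  · refine (norm_paramField_sub_le (hw t).1 b x y).trans ?_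
    have : C * (C * (C * ‖x - y‖)) = C ^ 3 * ‖x - y‖ := by ring
    rw [this]
    gcongr
    have : 0 ≤ C ^ 2 * β := by positivity
    nlinarith [sq_nonneg C]
  · have h1 : ‖paramField b (w t) 0‖ ≤ C * (C * β) := by
      refine norm_smul_transpose_le ((Param.abs_α_le _).trans (hw t).1)
        ((Param.norm_A_le _).trans (hw t).1) ?_
      simpa using hb
    have : 0 ≤ C ^ 3 := by positivity
    nlinarith [sq_nonneg C]
  · exact (continuous_paramField b z).comp_stronglyMeasurable hwm
  · exact mul_nonneg (hw t).2.1 (hw t).2.2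
  · have h1 : Param.α (w t) * Param.lam (w t) ≤ C * C :=
      mul_le_mul ((le_abs_self _).trans ((Param.abs_α_le _).trans (hw t).1))
        ((le_abs_self _).trans ((Param.abs_lam_le _).trans (hw t).1)) (hw t).2.2 hC
    have : 0 ≤ C ^ 3 := by positivity
    have : 0 ≤ C ^ 2 * β := by positivity
    nlinarith
  · exact (((Param.αL m n).continuous.comp_stronglyMeasurable hwm).measurable).mul
      (((Param.lamL m n).continuous.comp_stronglyMeasurable hwm).measurable)

end

section

variable {m n : ℕ} {p : ℝ≥0∞} {T : ℝ}

/-- `IsField` asks for its bounds at every time, whereas a control satisfies them only almost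
everywhere. Replacing the control by 0 on the measurable bad set repairs this. -/
theorem exists_bounded_representative {C : ℝ} (hC : 0 ≤ C) (u : Control m n p T)
    (hu : ∀ᵐ t ∂(timeMeasure T), ‖u t‖ ≤ C)
    (hu' : ∀ᵐ t ∂(timeMeasure T), 0 ≤ Param.α (u t) ∧ 0 ≤ Param.lam (u t)) :
    ∃ w : ℝ → Param m n, StronglyMeasurable w ∧
      (∀ t, ‖w t‖ ≤ C ∧ 0 ≤ Param.α (w t) ∧ 0 ≤ Param.lam (w t)) ∧ w =ᵐ[timeMeasure T] u := by
  have hum := Lp.stronglyMeasurable u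
  have h1 : Measurable fun t => Param.α (u t) :=
    ((Param.αL m n).continuous.comp_stronglyMeasurable hum).measurable
  have h2 : Measurable fun t => Param.lam (u t) :=
    ((Param.lamL m n).continuous.comp_stronglyMeasurable hum).measurable
  set S : Set ℝ := {t | ‖u t‖ ≤ C ∧ 0 ≤ Param.α (u t) ∧ 0 ≤ Param.lam (u t)} with hS
  have hSm : MeasurableSet S :=
    (measurableSet_le hum.norm.measurable measurable_const).inter
      ((measurableSet_le measurable_const h1).inter (measurableSet_le measurable_const h2))
  refine ⟨S.indicator u, hum.indicator hSm, fun t => ?_, ?_⟩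
  · by_cases ht : t ∈ S
    · rw [indicator_of_mem ht]; exact ht
    · rw [indicator_of_notMem ht, norm_zero]
      exact ⟨hC, le_rfl, le_rfl⟩
  · filter_upwards [hu, hu'] with t ht ht'
    exact indicator_of_mem (s := S) ⟨ht, ht'⟩ u

theorem isState_iff {R : Vec n → ℝ} {x₀ : Vec n} {b : Vec m} {u : Control m n p T}
    {w : ℝ → Param m n} (hw : w =ᵐ[timeMeasure T] u) {x : ℝ → Vec n} :
    IsState R x₀ b u x ↔ x 0 = x₀ ∧ IsApproxState R T (fun t x => paramField b (w t) x)
      (fun t => Param.α (w t) * Param.lam (w t)) 0 x x := by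
  constructor
  · rintro ⟨h1, h2, h3⟩
    refine ⟨h2, h1, ?_, fun t _ => by simp⟩
    filter_upwards [h3, hw] with t ht hwt
    rw [hwt]; exact ht
  · rintro ⟨h2, h1, h3, -⟩
    refine ⟨h1, h2, ?_⟩
    filter_upwards [h3, hw] with t ht hwt
    rw [hwt] at ht; exact ht

end

end FBSLimit

/-! ### Continuous dependence of the endpoint and the objective -/

namespace FBSLimit

section

variable {p : ℝ≥0∞} [Fact (1 ≤ p)] {T : ℝ} {E F : Type*} [NormedAddCommGroup E] 
  [NormedAddCommGroup F]

theorem integral_norm_rpow_eq (hp : p ≠ ∞) {μ : Measure ℝ} (f : Lp F p μ) :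
    ∫ t, ‖f t‖ ^ p.toReal ∂μ = ‖f‖ ^ p.toReal := by
  have hp1 : 1 ≤ p := Fact.out
  have hp0 : p ≠ 0 := (zero_lt_one.trans_le hp1).ne'
  have hI : 0 ≤ ∫ t, ‖f t‖ ^ p.toReal ∂μ := integral_nonneg fun t => by positivity
  rw [Lp.norm_def, (Lp.memLp f).eLpNorm_eq_integral_rpow_norm hp0 hp,
    ENNReal.toReal_ofReal (by positivity), Real.rpow_inv_rpow hI
    (ENNReal.toReal_pos hp0 hp).ne']

/-- Composition with Λ is a bounded linear map of L^p, and the integral is the p-th power of the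
norm of its value. The cases Λ = A, α, λ give the three regularization terms. -/
theorem continuous_integral_norm_rpow [NormedSpace ℝ E] [NormedSpace ℝ F] (hp : p ≠ ∞) {μ : Measure ℝ} (Λ : E →L[ℝ] F) :
    Continuous fun u : Lp E p μ => ∫ t, ‖Λ (u t)‖ ^ p.toReal ∂μ := by
  have h : ∀ u : Lp E p μ, ∫ t, ‖Λ (u t)‖ ^ p.toReal ∂μ = ‖Λ.compLpL p μ u‖ ^ p.toReal := by
    intro u
    rw [← integral_norm_rpow_eq hp]
    refine integral_congr_ae ?_
    filter_upwards [Λ.coeFn_compLpL u] with t ht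
    rw [ht]
  simp_rw [h]
  exact ((Λ.compLpL p μ).continuous.norm).rpow_const fun _ => Or.inr ENNReal.toReal_nonneg

/-- The interval has finite measure, so L^p convergence implies L¹ convergence, the form the state
estimate uses. -/
theorem tendsto_integral_norm_sub {us : ℕ → Lp E p (timeMeasure T)} {u : Lp E p (timeMeasure T)}
    (h : Tendsto us atTop (𝓝 u)) :
    Tendsto (fun k => ∫ t in Icc 0 T, ‖u t - us k t‖) atTop (𝓝 0) := by
  have hp1 : 1 ≤ p := Fact.out
  have h0 : Tendsto (fun k => eLpNorm (⇑u - ⇑(us k)) p (timeMeasure T)) atTop (𝓝 0) := by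
    have h1 := (tendsto_iff_edist_tendsto_0.mp h)
    refine h1.congr fun k => ?_
    rw [edist_comm, Lp.edist_def]
  set c := timeMeasure T univ ^ (1 / (1 : ℝ≥0∞).toReal - 1 / p.toReal) with hc
  have hcfin : c ≠ ∞ := by
    refine ENNReal.rpow_ne_top_of_nonneg ?_ (measure_ne_top _ _)
    rw [ENNReal.toReal_one, div_one, sub_nonneg]
    rcases eq_or_ne p ∞ with rfl | hp
    · simp
    · have : 1 ≤ p.toReal := by
        rw [← ENNReal.toReal_one]; exact ENNReal.toReal_mono hp hp1
      rw [div_le_one (by linarith)]; exact this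
  have h2 : Tendsto (fun k => eLpNorm (⇑u - ⇑(us k)) 1 (timeMeasure T)) atTop (𝓝 0) := by
    have h3 : Tendsto (fun k => eLpNorm (⇑u - ⇑(us k)) p (timeMeasure T) * c) atTop (𝓝 0) := by
      simpa using ENNReal.Tendsto.mul_const h0 (Or.inr hcfin)
    refine tendsto_of_tendsto_of_tendsto_of_le_of_le tendsto_const_nhds h3 (fun _ => zero_le)
      fun k => ?_
    exact eLpNorm_le_eLpNorm_mul_rpow_measure_univ hp1
      ((Lp.aestronglyMeasurable u).sub (Lp.aestronglyMeasurable (us k)))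
  have h4 := (ENNReal.tendsto_toReal ENNReal.zero_ne_top).comp h2
  rw [ENNReal.toReal_zero] at h4
  refine h4.congr fun k => ?_
  have hint : Integrable (⇑u - ⇑(us k)) (timeMeasure T) :=
    ((Lp.memLp u).integrable hp1).sub ((Lp.memLp (us k)).integrable hp1)
  rw [Function.comp_apply, eLpNorm_one_eq_lintegral_enorm, ← integral_norm_eq_lintegral_enorm
    hint.aestronglyMeasurable]
  rfl

end

section

variable {m n : ℕ} {p : ℝ≥0∞} {T : ℝ} {R : Vec n → ℝ} {M : ℝ} {C : ℝ}

theorem exists_isState (hT : 0 ≤ T) (hR : ConvexOn ℝ univ R) (hM : 0 ≤ M)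
    (hRM : ∀ z, ∀ g ∈ subdifferential R z, ‖g‖ ≤ M * (1 + ‖z‖)) (hC : 0 ≤ C) (x₀ : Vec n)
    (b : Vec m) (u : Control m n p T) (hu : ∀ᵐ t ∂(timeMeasure T), ‖u t‖ ≤ C)
    (hu' : ∀ᵐ t ∂(timeMeasure T), 0 ≤ Param.α (u t) ∧ 0 ≤ Param.lam (u t)) :
    ∃ x, IsState R x₀ b u x := by
  obtain ⟨w, hwm, hw, hwu⟩ := exists_bounded_representative hC u hu hu'
  obtain ⟨x, hx⟩ := exists_state hT (isField_of_param (le_refl ‖b‖) hwm hw) hM hR hRM x₀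
  exact ⟨x, (isState_iff hwu).mpr hx⟩

/-- Quantitative dependence of the state on the data and the control. -/
theorem exists_state_estimate (hT : 0 ≤ T) (hM : 0 ≤ M)
    (hRM : ∀ z, ∀ g ∈ subdifferential R z, ‖g‖ ≤ M * (1 + ‖z‖)) (hC : 0 ≤ C) {β X : ℝ}
    (hβ : 0 ≤ β) :
    ∃ c₁ c₂ c₃ : ℝ, ∀ (x₀ x₀' : Vec n) (b b' : Vec m) (u u' : Control m n p T) (x x' : ℝ → Vec n),
      ‖x₀‖ ≤ X → ‖x₀'‖ ≤ X → ‖b‖ ≤ β → ‖b'‖ ≤ β →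
      (∀ᵐ t ∂(timeMeasure T), ‖u t‖ ≤ C) → (∀ᵐ t ∂(timeMeasure T), ‖u' t‖ ≤ C) →
      (∀ᵐ t ∂(timeMeasure T), 0 ≤ Param.α (u t) ∧ 0 ≤ Param.lam (u t)) →
      (∀ᵐ t ∂(timeMeasure T), 0 ≤ Param.α (u' t) ∧ 0 ≤ Param.lam (u' t)) →
      IsState R x₀ b u x → IsState R x₀' b' u' x' →
      ‖x T - x' T‖ ^ 2 ≤ c₁ * ‖x₀ - x₀'‖ ^ 2 + c₂ * ‖b - b'‖
        + c₃ * ∫ t in Icc 0 T, ‖u t - u' t‖ := by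
  set K := C ^ 3 + C ^ 2 * β + C ^ 2 with hK
  have hK0 : 0 ≤ K := by positivity
  -- B is the a priori bound of `IsApproxState.norm_sq_le`. D below adds the Lipschitz constant of
  -- the smooth field in the parameter and that of αλ, the latter weighted by the subgradient bound
  -- M(1 + B).
  set B := √((X ^ 2 + T * (K * (1 + M))) * Real.exp (3 * (K * (1 + M)) * T)) with hB
  have hB0 : 0 ≤ B := Real.sqrt_nonneg _
  set D := 2 * (C * (C * B + β)) + C * (C * B) + 2 * C * (M * (1 + B)) with hD
  have hD0 : 0 ≤ D := by positivity
  -- These are the constants of `IsApproxState.norm_sub_sq_le` at ε = ε' = 0, once η is integrated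
  -- over [0, T].
  refine ⟨Real.exp (4 * K * T), 4 * B * (T * (C * C)) * Real.exp (4 * K * T),
    4 * B * D * Real.exp (4 * K * T), ?_⟩
  intro x₀ x₀' b b' u u' x x' hX hX' hb hb' hu hu' hs hs' hx hx'
  obtain ⟨w, hwm, hw, hwu⟩ := exists_bounded_representative hC u hu hs
  obtain ⟨w', hwm', hw', hwu'⟩ := exists_bounded_representative hC u' hu' hs'
  obtain ⟨hx0, hxs⟩ := (isState_iff hwu).mp hx
  obtain ⟨hx0', hxs'⟩ := (isState_iff hwu').mp hx'
  have hF := isField_of_param hb hwm hw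
  have hF' := isField_of_param hb' hwm' hw'
  rw [← hK] at hF hF'
  have bound : ∀ {a c} {z : ℝ → Vec n}, IsField K a c → IsApproxState R T a c 0 z z → ‖z 0‖ ≤ X →
      ∀ t ∈ Icc 0 T, ‖z t‖ ≤ B := by
    intro a c z hG hz hz0 t ht
    refine Real.le_sqrt_of_sq_le ((hz.norm_sq_le hT hG hM hRM t ht).trans ?_)
    gcongr
  have velocity : ∀ {a c} {z : ℝ → Vec n}, IsField K a c → IsApproxState R T a c 0 z z →
      ‖z 0‖ ≤ X → ∀ᵐ t ∂(timeMeasure T), ‖deriv z t‖ ≤ K * (1 + M) * (1 + B) := by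
    intro a c z hG hz hz0
    filter_upwards [hz.incl, ae_restrict_mem measurableSet_Icc] with t ⟨v, hv, g, hg, hvg⟩ ht
    rw [hv.deriv]
    refine (hG.norm_velocity_le hRM hg hvg).trans ?_
    have := bound hG hz hz0 t ht
    gcongr
  have hwi : IntegrableOn (fun t => ‖w t - w' t‖) (Icc 0 T) := by
    refine Measure.integrableOn_of_bounded (M := 2 * C) (by simp)
      (hwm.sub hwm').norm.aestronglyMeasurable (ae_of_all _ fun t => ?_)
    rw [norm_norm]
    exact (norm_sub_le _ _).trans (by linarith [(hw t).1, (hw' t).1])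
  have hci : IntegrableOn (fun _ : ℝ => C * (C * ‖b - b'‖)) (Icc 0 T) := integrable_const _
  have key := hxs.norm_sub_sq_le hT hF hxs' (B := B) (G := M * (1 + B))
    (η := fun t => D * ‖w t - w' t‖ + C * (C * ‖b - b'‖)) hB0
    (bound hF hxs (hx0 ▸ hX)) (bound hF' hxs' (hx0' ▸ hX'))
    (fun z hz g hg => (hRM z g hg).trans (by gcongr))
    (velocity hF hxs (hx0 ▸ hX)) (velocity hF' hxs' (hx0' ▸ hX')) (by positivity)
    (fun t => by positivity) ((hwi.const_mul _).add hci)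
    (ae_of_all _ fun t z hz => by
      have h1 := norm_paramField_sub_param_le (hw t).1 (hw' t).1 hb hz (b' := b')
      have h2 := mul_le_mul_of_nonneg_right (abs_α_mul_lam_sub_le (hw t).1 (hw' t).1)
        (by positivity : 0 ≤ M * (1 + B))
      rw [hD]
      linarith) T ⟨hT, le_rfl⟩
  have hint : ∫ t in Icc 0 T, (D * ‖w t - w' t‖ + C * (C * ‖b - b'‖))
      = D * (∫ t in Icc 0 T, ‖u t - u' t‖) + T * (C * (C * ‖b - b'‖)) := by
    rw [integral_add (hwi.const_mul _) hci, integral_const_mul]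
    congr 1
    · congr 1
      refine integral_congr_ae ?_
      filter_upwards [hwu, hwu'] with t h1 h2
      rw [h1, h2]
    · simp [hT]
  rw [hint, hx0, hx0'] at key
  refine key.trans (le_of_eq ?_)
  ring

/-- Convergent data are bounded, so one triple of constants in `exists_state_estimate` works along
the whole sequence. -/
theorem tendsto_state_endpoint [Fact (1 ≤ p)] (hT : 0 ≤ T) (hM : 0 ≤ M)
    (hRM : ∀ z, ∀ g ∈ subdifferential R z, ‖g‖ ≤ M * (1 + ‖z‖)) (hC : 0 ≤ C)
    {D : Set (Control m n p T)} (hDC : ∀ u ∈ D, ∀ᵐ t ∂(timeMeasure T), ‖u t‖ ≤ C)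
    (hD : ∀ u ∈ D, ∀ᵐ t ∂(timeMeasure T), 0 ≤ Param.α (u t) ∧ 0 ≤ Param.lam (u t))
    {x₀s : ℕ → Vec n} {x₀ : Vec n} {bs : ℕ → Vec m} {b : Vec m} {us : ℕ → Control m n p T}
    {u : Control m n p T} {xs : ℕ → ℝ → Vec n} {x : ℝ → Vec n}
    (hx₀ : Tendsto x₀s atTop (𝓝 x₀)) (hb : Tendsto bs atTop (𝓝 b)) (hu : Tendsto us atTop (𝓝 u))
    (husD : ∀ k, us k ∈ D) (huD : u ∈ D) (hxs : ∀ k, IsState R (x₀s k) (bs k) (us k) (xs k))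
    (hx : IsState R x₀ b u x) : Tendsto (fun k => xs k T) atTop (𝓝 (x T)) := by
  obtain ⟨X, hX⟩ := (Metric.isBounded_range_of_tendsto x₀s hx₀).exists_norm_le
  obtain ⟨β, hβ⟩ := (Metric.isBounded_range_of_tendsto bs hb).exists_norm_le
  have hX' : ∀ k, ‖x₀s k‖ ≤ X := fun k => hX _ (mem_range_self k)
  have hβ' : ∀ k, ‖bs k‖ ≤ β := fun k => hβ _ (mem_range_self k)
  have hXl : ‖x₀‖ ≤ X := le_of_tendsto' hx₀.norm hX'
  have hβl : ‖b‖ ≤ β := le_of_tendsto' hb.norm hβ'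
  obtain ⟨c₁, c₂, c₃, hc⟩ := exists_state_estimate (p := p) (m := m) hT hM hRM hC (X := X)
    ((norm_nonneg b).trans hβl)
  have h1 : Tendsto (fun k => c₁ * ‖x₀ - x₀s k‖ ^ 2 + c₂ * ‖b - bs k‖
      + c₃ * ∫ t in Icc 0 T, ‖u t - us k t‖) atTop (𝓝 0) := by
    simpa using ((((hx₀.const_sub x₀).norm.pow 2).const_mul c₁).add
      ((hb.const_sub b).norm.const_mul c₂)).add ((tendsto_integral_norm_sub hu).const_mul c₃)
  have h2 : Tendsto (fun k => ‖x T - xs k T‖ ^ 2) atTop (𝓝 0) :=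
    squeeze_zero (fun k => by positivity) (fun k => hc x₀ (x₀s k) b (bs k) u (us k) x (xs k)
      hXl (hX' k) hβl (hβ' k) (hDC u huD) (hDC _ (husD k)) (hD u huD) (hD _ (husD k)) hx (hxs k)) h1
  have h3 : Tendsto (fun k => ‖x T - xs k T‖) atTop (𝓝 0) := by
    have := h2.sqrt
    simpa [Real.sqrt_sq] using this
  rw [tendsto_iff_norm_sub_tendsto_zero]
  simpa only [norm_sub_rev] using h3

theorem tendsto_objective [Fact (1 ≤ p)] (hp : p ≠ ∞) {L : Vec n → Vec n → ℝ} {ψ : ℝ → ℝ} {β₁ β₂ β₃ : ℝ}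
    (hL : Continuous fun q : Vec n × Vec n => L q.1 q.2) (hψ : Continuous ψ)
    {ys : ℕ → Vec n} {y : Vec n} {us : ℕ → Control m n p T} {u : Control m n p T}
    {xs : ℕ → ℝ → Vec n} {x : ℝ → Vec n} (hy : Tendsto ys atTop (𝓝 y))
    (hu : Tendsto us atTop (𝓝 u)) (hx : Tendsto (fun k => xs k T) atTop (𝓝 (x T))) :
    Tendsto (fun k => objective L ψ β₁ β₂ β₃ (ys k) (us k) (xs k)) atTop
      (𝓝 (objective L ψ β₁ β₂ β₃ y u x)) := by
  have h0 := (hL.tendsto (x T, y)).comp (hx.prodMk_nhds hy)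
  have h1 := ((continuous_integral_norm_rpow hp (Param.AL m n)).tendsto u).comp hu
  have h2 := ((continuous_integral_norm_rpow hp (Param.αL m n)).tendsto u).comp hu
  have h3 := ((continuous_integral_norm_rpow hp (Param.lamL m n)).tendsto u).comp hu
  exact ((h0.add (((hψ.tendsto _).comp (h1.const_mul T⁻¹)).const_mul β₁)).add
    (((hψ.tendsto _).comp (h2.const_mul T⁻¹)).const_mul β₂)).add
    (((hψ.tendsto _).comp (h3.const_mul T⁻¹)).const_mul β₃)

end

end FBSLimit

/-! ### Passage to the limit in the minimization problems -/

namespace FBSLimit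

section

variable {m n : ℕ} {p : ℝ≥0∞} {T : ℝ} {R : Vec n → ℝ} {M C : ℝ} {L : Vec n → Vec n → ℝ}
  {ψ : ℝ → ℝ} {β₁ β₂ β₃ : ℝ} {D : Set (Control m n p T)}

theorem optimalValue_eq {x₀ : Vec n} {b : Vec m} {y : Vec n} {u : Control m n p T}
    {x : ℝ → Vec n} (huD : u ∈ D) (hx : IsState R x₀ b u x)
    (hmin : ∀ v ∈ D, ∀ z, IsState R x₀ b v z →
      objective L ψ β₁ β₂ β₃ y u x ≤ objective L ψ β₁ β₂ β₃ y v z) :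
    optimalValue R L ψ β₁ β₂ β₃ D x₀ b y = objective L ψ β₁ β₂ β₃ y u x := by
  refine IsLeast.csInf_eq ⟨⟨u, huD, x, hx, rfl⟩, ?_⟩
  rintro _ ⟨v, hv, z, hz, rfl⟩
  exact hmin v hv z hz

/-- Both sides of J_k(u_k) ≤ J_k(v) converge: the left because u_k → u, the right because v is kept
fixed and only the data move. The first limit also gives the optimal values, since these are
attained at u_k and at u. -/
theorem mem_solutionSet_of_tendsto [Fact (1 ≤ p)] (hp : p ≠ ∞) (hT : 0 ≤ T)
    (hR : ConvexOn ℝ univ R) (hM : 0 ≤ M)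
    (hRM : ∀ z, ∀ g ∈ subdifferential R z, ‖g‖ ≤ M * (1 + ‖z‖))
    (hL : Continuous fun q : Vec n × Vec n => L q.1 q.2) (hψ : Continuous ψ)
    (hC : 0 ≤ C) (hDC : ∀ u ∈ D, ∀ᵐ t ∂(timeMeasure T), ‖u t‖ ≤ C)
    (hD : ∀ u ∈ D, ∀ᵐ t ∂(timeMeasure T), 0 ≤ Param.α (u t) ∧ 0 ≤ Param.lam (u t))
    {x₀s : ℕ → Vec n} {x₀ : Vec n} {bs : ℕ → Vec m} {b : Vec m} {ys : ℕ → Vec n} {y : Vec n}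
    {us : ℕ → Control m n p T} {u : Control m n p T}
    (hx₀ : Tendsto x₀s atTop (𝓝 x₀)) (hb : Tendsto bs atTop (𝓝 b)) (hy : Tendsto ys atTop (𝓝 y))
    (hu : Tendsto us atTop (𝓝 u)) (huD : u ∈ D)
    (hus : ∀ k, us k ∈ solutionSet R L ψ β₁ β₂ β₃ D (x₀s k) (bs k) (ys k)) :
    u ∈ solutionSet R L ψ β₁ β₂ β₃ D x₀ b y ∧
      Tendsto (fun k => optimalValue R L ψ β₁ β₂ β₃ D (x₀s k) (bs k) (ys k)) atTop
        (𝓝 (optimalValue R L ψ β₁ β₂ β₃ D x₀ b y)) := by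
  choose husD xs hxs hmin using hus
  obtain ⟨x, hx⟩ := exists_isState hT hR hM hRM hC x₀ b u (hDC u huD) (hD u huD)
  have hlim : Tendsto (fun k => objective L ψ β₁ β₂ β₃ (ys k) (us k) (xs k)) atTop
      (𝓝 (objective L ψ β₁ β₂ β₃ y u x)) :=
    tendsto_objective hp hL hψ hy hu
      (tendsto_state_endpoint hT hM hRM hC hDC hD hx₀ hb hu husD huD hxs hx)
  have hopt : ∀ v ∈ D, ∀ z, IsState R x₀ b v z →
      objective L ψ β₁ β₂ β₃ y u x ≤ objective L ψ β₁ β₂ β₃ y v z := by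
    intro v hv z hz
    choose zs hzs using fun k =>
      exists_isState hT hR hM hRM hC (x₀s k) (bs k) v (hDC v hv) (hD v hv)
    refine le_of_tendsto_of_tendsto' hlim (tendsto_objective hp hL hψ hy tendsto_const_nhds
      (tendsto_state_endpoint hT hM hRM hC hDC hD hx₀ hb tendsto_const_nhds (fun _ => hv) hv
        hzs hz)) fun k => hmin k v hv _ (hzs k)
  refine ⟨⟨huD, x, hx, hopt⟩, ?_⟩
  rw [optimalValue_eq huD hx hopt]
  exact hlim.congr fun k => (optimalValue_eq (husD k) (hxs k) (hmin k)).symm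

end

end FBSLimit

theorem mainTheorem5 {m n : ℕ} {p : ℝ≥0∞} [Fact (1 ≤ p)] (hp : p ≠ ∞) {T : ℝ} (hT : 0 < T)
    (R : FBSLimit.Vec n → ℝ) (L : FBSLimit.Vec n → FBSLimit.Vec n → ℝ) (ψ : ℝ → ℝ)
    (β₁ β₂ β₃ : ℝ) (hβ₁ : 0 ≤ β₁) (hβ₂ : 0 ≤ β₂) (hβ₃ : 0 ≤ β₃)
    (hA1 : ConvexOn ℝ univ R)
    (hA2 : (0 : FBSLimit.Vec n) ∈ FBSLimit.subdifferential R 0)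
    (hA3 : ∃ M : ℝ, 0 < M ∧ ∀ x : FBSLimit.Vec n,
      (∀ z ∈ FBSLimit.subdifferential R x, ‖z‖ ≤ M * ‖x‖) ∨
      (∀ z ∈ FBSLimit.subdifferential R x, ‖z‖ ≤ M))
    (hA4 : Continuous (fun q : FBSLimit.Vec n × FBSLimit.Vec n => L q.1 q.2))
    (hA4' : ∀ x y : FBSLimit.Vec n, 0 ≤ L x y)
    (hA5 : LocallyLipschitz ψ) (hA5' : ∀ s : ℝ, 0 ≤ ψ s)
    (D : Set (FBSLimit.Control m n p T))
    (hDnonneg : ∀ u ∈ D, ∀ᵐ t ∂(FBSLimit.timeMeasure T),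
      0 ≤ FBSLimit.Param.α (u t) ∧ 0 ≤ FBSLimit.Param.lam (u t))
    (hDbdd : FBSLimit.BoundedLinfty D) (hDclosed : IsClosed D)
    (hDequi : FBSLimit.EquicontinuousLp D)
    (x₀ : FBSLimit.Vec n) (b : FBSLimit.Vec m) (y : FBSLimit.Vec n)
    (x₀s : ℕ → FBSLimit.Vec n) (bs : ℕ → FBSLimit.Vec m) (ys : ℕ → FBSLimit.Vec n)
    (hconv : Tendsto (fun r => (x₀s r, bs r, ys r)) atTop (𝓝 (x₀, b, y)))
    (us : ℕ → FBSLimit.Control m n p T)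
    (hus : ∀ r, us r ∈ FBSLimit.solutionSet R L ψ β₁ β₂ β₃ D (x₀s r) (bs r) (ys r)) :
    (∃ (φ : ℕ → ℕ) (u : FBSLimit.Control m n p T),
      StrictMono φ ∧ Tendsto (us ∘ φ) atTop (𝓝 u)) ∧
    (∀ u : FBSLimit.Control m n p T, MapClusterPt u atTop us →
      u ∈ FBSLimit.solutionSet R L ψ β₁ β₂ β₃ D x₀ b y) ∧
    Tendsto (fun r => ⨅ u ∈ FBSLimit.solutionSet R L ψ β₁ β₂ β₃ D x₀ b y, ‖us r - u‖ₑ)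
      atTop (𝓝 0) ∧
    Tendsto (fun r => FBSLimit.optimalValue R L ψ β₁ β₂ β₃ D (x₀s r) (bs r) (ys r))
      atTop (𝓝 (FBSLimit.optimalValue R L ψ β₁ β₂ β₃ D x₀ b y)) := by
  obtain ⟨M, hM, hRM⟩ := hA3
  -- Either alternative of the growth assumption implies this single linear bound.
  have hRM' : ∀ z, ∀ g ∈ FBSLimit.subdifferential R z, ‖g‖ ≤ M * (1 + ‖z‖) := by
    intro z g hg
    rcases hRM z with h | h
    · exact (h g hg).trans (by gcongr; linarith)
    · exact (h g hg).trans (le_mul_of_one_le_right hM.le (by linarith [norm_nonneg z]))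
  obtain ⟨C, hC⟩ := hDbdd
  have hDC : ∀ u ∈ D, ∀ᵐ t ∂(FBSLimit.timeMeasure T), ‖u t‖ ≤ |C| := fun u hu =>
    (hC u hu).mono fun t ht => ht.trans (le_abs_self C)
  have hK : IsCompact D :=
    FBSLimit.isCompact_of_equicontinuous_translations hp hC hDclosed hDequi
  have husD : ∀ r, us r ∈ D := fun r => (hus r).1
  have hx₀ : Tendsto x₀s atTop (𝓝 x₀) := (continuous_fst.tendsto _).comp hconv
  have hb : Tendsto bs atTop (𝓝 b) :=
    ((continuous_fst.comp continuous_snd).tendsto _).comp hconv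
  have hy : Tendsto ys atTop (𝓝 y) :=
    ((continuous_snd.comp continuous_snd).tendsto _).comp hconv
  have key : ∀ (φ : ℕ → ℕ) (u : FBSLimit.Control m n p T), Tendsto φ atTop atTop →
      Tendsto (fun k => us (φ k)) atTop (𝓝 u) → u ∈ D →
      u ∈ FBSLimit.solutionSet R L ψ β₁ β₂ β₃ D x₀ b y ∧
        Tendsto (fun k => FBSLimit.optimalValue R L ψ β₁ β₂ β₃ D (x₀s (φ k)) (bs (φ k)) (ys (φ k)))
          atTop (𝓝 (FBSLimit.optimalValue R L ψ β₁ β₂ β₃ D x₀ b y)) := fun φ u hφ hu huD =>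
    FBSLimit.mem_solutionSet_of_tendsto hp hT.le hA1 hM.le hRM' hA4 hA5.continuous (abs_nonneg C)
      hDC hDnonneg (hx₀.comp hφ) (hb.comp hφ) (hy.comp hφ) hu huD fun k => hus (φ k)
  have hsub : ∀ φ : ℕ → ℕ, ∃ (χ : ℕ → ℕ) (u : FBSLimit.Control m n p T),
      StrictMono χ ∧ u ∈ D ∧ Tendsto (fun k => us (φ (χ k))) atTop (𝓝 u) := by
    intro φ
    obtain ⟨u, huD, χ, hχ, hlim⟩ := hK.tendsto_subseq fun k => husD (φ k)
    exact ⟨χ, u, hχ, huD, hlim⟩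
  refine ⟨?_, ?_, ?_, ?_⟩
  · obtain ⟨χ, u, hχ, -, hlim⟩ := hsub id
    exact ⟨χ, u, hχ, hlim⟩
  · intro u hu
    -- L^p is first countable, so a cluster point is the limit of a subsequence.
    obtain ⟨φ, hφ, hlim⟩ := hu.tendsto_subseq
    exact (key φ u hφ.tendsto_atTop hlim
      (hDclosed.mem_of_tendsto hlim (Eventually.of_forall fun k => husD (φ k)))).1
  · refine tendsto_of_subseq_tendsto fun φ hφ => ?_
    obtain ⟨χ, u, hχ, huD, hlim⟩ := hsub φ
    refine ⟨χ, ?_⟩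
    have huS := (key _ u (hφ.comp hχ.tendsto_atTop) hlim huD).1
    have h0 : Tendsto (fun k => ‖us (φ (χ k)) - u‖ₑ) atTop (𝓝 0) := by
      simpa only [edist_eq_enorm_sub] using tendsto_iff_edist_tendsto_0.mp hlim
    -- The distance to S is an infimum in `ℝ≥0∞`, equal to ∞ for empty S; the limit u ∈ S bounds it
    -- by ‖us (φ (χ k)) - u‖ₑ.
    exact tendsto_of_tendsto_of_tendsto_of_le_of_le tendsto_const_nhds h0 (fun _ => zero_le)
      fun k => iInf₂_le u huS
  · refine tendsto_of_subseq_tendsto fun φ hφ => ?_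
    obtain ⟨χ, u, hχ, huD, hlim⟩ := hsub φ
    exact ⟨χ, (key _ u (hφ.comp hχ.tendsto_atTop) hlim huD).2⟩
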